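/- All graphs below are 2-colourings (red/blue) of the edges of a complete graph; a monochromatic complete subgraph is identified with its vertex set, so it is a set of vertices all of whose pairs have the same colour. Let $\log$ denote the binary logarithm. Fix a function $\varepsilon:\mathbb N\to\mathbb R$ with $\varepsilon(n)\to 0$, and call a 2-coloured complete graph $G$ on $n$ vertices \emph{Half-Ramsey} if every monochromatic complete subgraph of $G$ has fewer than $(\frac12+\varepsilon(n))\log n$ vertices. Define, for $0\le c\le 1$, $$g(c)=\begin{cases}\frac12\left(4-c\log e+(1-c)^2\log(1-c)-(2-c)^2\log(2-c)\right), & 0\le c<1,\\ \frac12(4-\log e), & c=1,\end{cases}$$ and $g_1(c)=\frac14 g(2c)$ for $0\le c\le\frac12$. The function $g_1$ is concave and strictly increasing on $[0,\frac12]$. Moreover: (1) For every constant $0\le c\le \frac12$ there is a function $\eta(n)\to0$ (depending only on $\varepsilon$ and $c$) such that, for all sufficiently large $n$, every Half-Ramsey graph $G$ on $n$ vertices and every integer $k$ with $|k-c\log n|<1$ (that is, $c\log n$ rounded up or down), the number of monochromatic complete subgraphs of $G$ of size exactly $k$ is at least $n^{(g_1(c)-\eta(n))\log n}$ and at most $n^{(g_1(c)+\eta(n))\log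 n}$. (2) There is a function $\eta(n)\to0$ (depending only on $\varepsilon$) such that, for all sufficiently large $n$, every Half-Ramsey graph $G$ on $n$ vertices has at least $n^{(\frac18(4-\log e)-\eta(n))\log n}$ monochromatic complete subgraphs of size at least $\frac12\log n$, and at most $n^{(\frac18(4-\log e)+\eta(n))\log n}$ monochromatic complete subgraphs in total. In particular the total number is $n^{(\frac18(4-\log e)\pm o(1))\log n}$. -/

import Mathlib

open Filter Topology

namespace HalfRamsey

noncomputable section

/-- A 2-colouring (red/blue) of the edges of the complete graph on `n` vertices is recorded by the
graph `G` of its red edges; the blue edges are the non-edges of `G`. The vertex set `s` spans a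
monochromatic complete subgraph if all its pairs are red (a clique) or all are blue (an
independent set). -/
def IsMonochromatic {n : ℕ} (G : SimpleGraph (Fin n)) (s : Finset (Fin n)) : Prop :=
  G.IsClique (s : Set (Fin n)) ∨ G.IsIndepSet (s : Set (Fin n))

open Classical in
/-- The monochromatic complete subgraphs of a 2-coloured complete graph, as vertex sets. -/
def monoSubgraphs {n : ℕ} (G : SimpleGraph (Fin n)) : Finset (Finset (Fin n)) :=
  Finset.univ.filter fun s => IsMonochromatic G s

/-- The number of monochromatic complete subgraphs on exactly `k` vertices. -/
def numMono {n : ℕ} (G : SimpleGraph (Fin n)) (k : ℕ) : ℕ :=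
  ((monoSubgraphs G).filter fun s => s.card = k).card

/-- The number of monochromatic complete subgraphs on at least `x` vertices, `x` real. -/
def numMonoGE {n : ℕ} (G : SimpleGraph (Fin n)) (x : ℝ) : ℕ :=
  ((monoSubgraphs G).filter fun s => x ≤ (s.card : ℝ)).card

/-- The total number of monochromatic complete subgraphs. -/
def totalMono {n : ℕ} (G : SimpleGraph (Fin n)) : ℕ :=
  (monoSubgraphs G).card

/-- `G` has no monochromatic complete subgraph of size `(1/2 + ε) log₂ n` (or larger). A
Half-Ramsey graph on `n` vertices is one with this property for `ε = ε n`, where the fixed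
function `ε : ℕ → ℝ` tends to `0`: this is the `o(1)` of the definition. -/
def IsHalfRamsey (ε : ℕ → ℝ) {n : ℕ} (G : SimpleGraph (Fin n)) : Prop :=
  ∀ s : Finset (Fin n), IsMonochromatic G s →
    (s.card : ℝ) < (1 / 2 + ε n) * Real.logb 2 n

/-- The function `g` on `[0, 1]`; `Real.logb 2` is the binary logarithm. -/
def g (c : ℝ) : ℝ :=
  if c < 1 then
    1 / 2 * (4 - c * Real.logb 2 (Real.exp 1) + (1 - c) ^ 2 * Real.logb 2 (1 - c)
      - (2 - c) ^ 2 * Real.logb 2 (2 - c))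
  else 1 / 2 * (4 - Real.logb 2 (Real.exp 1))

/-- The profile `g₁` of Half-Ramsey graphs. -/
def g₁ (c : ℝ) : ℝ :=
  if c ≤ 1 / 2 then 1 / 4 * g (2 * c) else 0

end

end HalfRamsey

/-! The two directions have different sources. A Half-Ramsey graph has no monochromatic set larger
than `k = (1/2 + o(1)) log n`, so `n` is at least `4 ^ ((1 - o(1)) k)`. But diagonal Ramsey numbers
are at most `4 ^ k` times an exponentially small factor (`exists_exponential_improvement`). Hence no
Half-Ramsey graph exists for large `n` (`eventually_not_isHalfRamsey`), and the lower bounds hold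
vacuously.

The improvement comes from a book algorithm. If some vertex has atypical degrees, its larger
neighbourhood beats the factor `1/2` that Erdős–Szekeres allows; many such moves already give the
gain (`exists_balanced`). Otherwise both colours have density about `1/2` at every vertex, and
`exists_book` finds a monochromatic clique of size `t` joined to nearly `2 ^ (-t) |S|` pages. Among
the pages the two clique bounds differ by at least `t / 2`, so the Erdős–Szekeres binomial
coefficient is off centre and smaller by `exp (-t ^ 2 / (32 k))`. Each step of the algorithm rests
on `exists_level`: positive correlations of neighbourhoods in both colours yield a pivot which loses
little density in either colour, or gains so much in one colour that the vertices lost from the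
reservoir are paid for.

The upper bounds are proved directly, without nonexistence. A clique on `i` vertices has a common
neighbourhood whose clique bound in its colour has dropped by `i`; Erdős–Szekeres bounds its size,
hence the number of extensions. The product over `i` becomes, in logarithms, a Riemann sum of
`slope` with integral `gNat`, the function `g` up to the base of the logarithm (`sum_slope_le`,
`card_cliques_le`). Concavity and monotonicity of `g₁` follow because `slope` is positive and
decreasing. -/

namespace HalfRamsey

/-! ### The geometric lemma on Gram kernels. -/

/-- The entire function `∑ xⁿ / (2n)!`, equal to `cosh √x` for `x ≥ 0`. -/
noncomputable def coshSqrt (x : ℝ) : ℝ :=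
  if 0 ≤ x then Real.cosh (√x) else Real.cos (√(-x))

theorem hasSum_coshSqrt (x : ℝ) :
    HasSum (fun n : ℕ => x ^ n / ((2 * n).factorial : ℝ)) (coshSqrt x) := by
  unfold coshSqrt
  split_ifs with h
  · have := Real.hasSum_cosh (√x)
    simpa only [pow_mul, Real.sq_sqrt h] using this
  · push Not at h
    have := Real.hasSum_cos (√(-x))
    simp only [pow_mul, Real.sq_sqrt (by linarith : (0:ℝ) ≤ -x)] at this
    convert this using 2 with n
    rw [← mul_pow]
    simp

theorem coshSqrt_of_neg_mem {x : ℝ} (hx : x < 0) : -1 ≤ coshSqrt x ∧ coshSqrt x ≤ 1 := by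
  rw [coshSqrt, if_neg (by linarith)]
  exact ⟨Real.neg_one_le_cos _, Real.cos_le_one _⟩

theorem one_add_half_le_coshSqrt {x : ℝ} (hx : 0 ≤ x) : 1 + x / 2 ≤ coshSqrt x := by
  have h := hasSum_coshSqrt x
  have := sum_le_hasSum (Finset.range 2) (fun n _ => by positivity) h
  simpa [Finset.sum_range_succ, Nat.factorial] using this

theorem coshSqrt_le_exp {x : ℝ} (hx : 0 ≤ x) : coshSqrt x ≤ Real.exp (√x) := by
  rw [coshSqrt, if_pos hx, Real.cosh_eq]
  have : Real.exp (-√x) ≤ Real.exp (√x) := Real.exp_le_exp.2 (by linarith [Real.sqrt_nonneg x])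
  linarith

theorem sum_rotate {α β γ : Type*} (X : Finset α) (X' : Finset β) (Y : Finset γ)
    (f : α → β → γ → ℝ) :
    ∑ x ∈ X, ∑ x' ∈ X', ∑ y ∈ Y, f x x' y = ∑ y ∈ Y, ∑ x ∈ X, ∑ x' ∈ X', f x x' y :=
  (Finset.sum_congr rfl fun _ _ => Finset.sum_comm).trans Finset.sum_comm

/-- Nonnegativity of a power of a Gram kernel, as a quadratic form. -/
theorem sum_mul_gram_pow_nonneg {α ι : Type*} (X : Finset α) (Y : Finset ι) (b : α → ι → ℝ)
    (n : ℕ) (w : α → ℝ) :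
    0 ≤ ∑ x ∈ X, ∑ x' ∈ X, w x * w x' * (∑ y ∈ Y, b x y * b x' y) ^ n := by
  induction n generalizing w with
  | zero =>
    have : ∑ x ∈ X, ∑ x' ∈ X, w x * w x' * (∑ y ∈ Y, b x y * b x' y) ^ 0
        = (∑ x ∈ X, w x) ^ 2 := by
      simp [sq, Finset.sum_mul_sum]
    rw [this]; positivity
  | succ n ih =>
    have : ∑ x ∈ X, ∑ x' ∈ X, w x * w x' * (∑ y ∈ Y, b x y * b x' y) ^ (n + 1)
        = ∑ y ∈ Y, ∑ x ∈ X, ∑ x' ∈ X,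
          (w x * b x y) * (w x' * b x' y) * (∑ y ∈ Y, b x y * b x' y) ^ n := by
      rw [← sum_rotate]
      refine Finset.sum_congr rfl fun x _ => Finset.sum_congr rfl fun x' _ => ?_
      rw [pow_succ, Finset.mul_sum, Finset.mul_sum]
      exact Finset.sum_congr rfl fun y _ => by ring
    rw [this]
    exact Finset.sum_nonneg fun y _ => ih _

/-- Expanding the first kernel over `y` leaves quadratic forms with weights `a x y`. These moment
inequalities are the only information about the graph that `exists_level` uses. -/
theorem sum_gram_mul_gram_pow_nonneg {α ι κ : Type*} (X : Finset α) (Y : Finset ι) (Z : Finset κ)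
    (a : α → ι → ℝ) (b : α → κ → ℝ) (n : ℕ) :
    0 ≤ ∑ x ∈ X, ∑ x' ∈ X, (∑ y ∈ Y, a x y * a x' y) * (∑ z ∈ Z, b x z * b x' z) ^ n := by
  have : ∑ x ∈ X, ∑ x' ∈ X, (∑ y ∈ Y, a x y * a x' y) * (∑ z ∈ Z, b x z * b x' z) ^ n
      = ∑ y ∈ Y, ∑ x ∈ X, ∑ x' ∈ X, a x y * a x' y * (∑ z ∈ Z, b x z * b x' z) ^ n := by
    rw [← sum_rotate]
    exact Finset.sum_congr rfl fun x _ => Finset.sum_congr rfl fun x' _ => by rw [Finset.sum_mul]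
  rw [this]
  exact Finset.sum_nonneg fun y _ => sum_mul_gram_pow_nonneg X Z b n _

/-- The test function of the geometric lemma: negative unless both arguments are at least `-6`. -/
noncomputable def testFun (x y : ℝ) : ℝ := x * (2 + coshSqrt y) + y * (2 + coshSqrt x)

theorem testFun_comm (x y : ℝ) : testFun x y = testFun y x := by
  unfold testFun; ring

/-- The threshold `6` balances two linear bounds: for `y ≥ 0` the first term is at most `-6 (3 + y /
2)`, while the second is at most `3 y` because `coshSqrt x ≤ 1` for negative `x`. -/
theorem testFun_le_neg_one {x y : ℝ} (hx : x < -6) : testFun x y ≤ -1 := by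
  unfold testFun
  have hcx := coshSqrt_of_neg_mem (show x < 0 by linarith)
  rcases lt_or_ge y 0 with hy | hy
  · have hcy := coshSqrt_of_neg_mem hy
    nlinarith
  · have hcy := one_add_half_le_coshSqrt hy
    nlinarith

theorem mul_two_add_coshSqrt_le {x y z : ℝ} (hx : x ≤ z) (hy : y ≤ z) (hz : 0 ≤ z) :
    x * (2 + coshSqrt y) ≤ 6 * Real.exp (2 * √z) := by
  have hc : 1 ≤ 2 + coshSqrt y ∧ 2 + coshSqrt y ≤ 3 * Real.exp (√z) := by
    have h1 : 1 ≤ Real.exp (√z) := Real.one_le_exp (Real.sqrt_nonneg z)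
    rcases lt_or_ge y 0 with hy0 | hy0
    · have hcy := coshSqrt_of_neg_mem hy0
      constructor <;> linarith
    · have h2 := one_add_half_le_coshSqrt hy0
      have h3 := coshSqrt_le_exp hy0
      have h4 : Real.exp (√y) ≤ Real.exp (√z) := Real.exp_le_exp.2 (Real.sqrt_le_sqrt hy)
      constructor <;> linarith
  have h5 : z ≤ 2 * Real.exp (√z) := by
    have := Real.quadratic_le_exp_of_nonneg (Real.sqrt_nonneg z)
    rw [Real.sq_sqrt hz] at this
    linarith [Real.sqrt_nonneg z]
  calc x * (2 + coshSqrt y) ≤ z * (2 + coshSqrt y) :=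
        mul_le_mul_of_nonneg_right hx (by linarith)
    _ ≤ (2 * Real.exp (√z)) * (3 * Real.exp (√z)) := by
        apply mul_le_mul h5 hc.2 (by linarith) (by positivity)
    _ = 6 * Real.exp (2 * √z) := by rw [two_mul (√z), Real.exp_add]; ring

theorem testFun_le_exp {u v w : ℝ} (hu : u ≤ w) (hv : v ≤ w) (hw : -1 ≤ w) :
    testFun (6 * u) (6 * v) ≤ 12 * Real.exp (5 * √(w + 1)) := by
  have h1 := mul_two_add_coshSqrt_le (x := 6 * u) (y := 6 * v) (z := 6 * (w + 1))
    (by linarith) (by linarith) (by linarith)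
  have h2 := mul_two_add_coshSqrt_le (x := 6 * v) (y := 6 * u) (z := 6 * (w + 1))
    (by linarith) (by linarith) (by linarith)
  have h3 : 2 * √(6 * (w + 1)) ≤ 5 * √(w + 1) := by
    rw [Real.sqrt_mul (by norm_num), ← mul_assoc]
    refine mul_le_mul_of_nonneg_right ?_ (Real.sqrt_nonneg _)
    have : √6 ≤ 5 / 2 := by
      rw [show (5 / 2 : ℝ) = √((5 / 2) ^ 2) by rw [Real.sqrt_sq (by norm_num)]]
      exact Real.sqrt_le_sqrt (by norm_num)
    linarith
  have h4 := Real.exp_le_exp.2 h3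
  unfold testFun
  linarith

/-- All Taylor coefficients of `coshSqrt` are nonnegative, so nonnegativity passes from the moments
to the series term by term. -/
theorem sum_testFun_nonneg {α : Type*} (X : Finset α) (u v : α → α → ℝ)
    (huv : ∀ n : ℕ, 0 ≤ ∑ x ∈ X, ∑ x' ∈ X, u x x' * v x x' ^ n)
    (hvu : ∀ n : ℕ, 0 ≤ ∑ x ∈ X, ∑ x' ∈ X, v x x' * u x x' ^ n) :
    0 ≤ ∑ x ∈ X, ∑ x' ∈ X, testFun (u x x') (v x x') := by
  have key : ∀ u v : α → α → ℝ, (∀ n : ℕ, 0 ≤ ∑ x ∈ X, ∑ x' ∈ X, u x x' * v x x' ^ n) →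
      0 ≤ ∑ x ∈ X, ∑ x' ∈ X, u x x' * (2 + coshSqrt (v x x')) := by
    intro u v h
    have h0 : 0 ≤ ∑ x ∈ X, ∑ x' ∈ X, u x x' * coshSqrt (v x x') := by
      have hs : HasSum (fun n : ℕ => ∑ x ∈ X, ∑ x' ∈ X,
          u x x' * (v x x' ^ n / ((2 * n).factorial : ℝ)))
          (∑ x ∈ X, ∑ x' ∈ X, u x x' * coshSqrt (v x x')) :=
        hasSum_sum fun x _ => hasSum_sum fun x' _ => (hasSum_coshSqrt _).mul_left _
      refine hs.nonneg fun n => ?_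
      have : ∑ x ∈ X, ∑ x' ∈ X, u x x' * (v x x' ^ n / ((2 * n).factorial : ℝ))
          = (∑ x ∈ X, ∑ x' ∈ X, u x x' * v x x' ^ n) / ((2 * n).factorial : ℝ) := by
        simp_rw [Finset.sum_div, mul_div_assoc]
      rw [this]
      exact div_nonneg (h n) (by positivity)
    have h1 := h 0
    simp only [pow_zero, mul_one] at h1
    have : ∑ x ∈ X, ∑ x' ∈ X, u x x' * (2 + coshSqrt (v x x'))
        = 2 * ∑ x ∈ X, ∑ x' ∈ X, u x x' + ∑ x ∈ X, ∑ x' ∈ X, u x x' * coshSqrt (v x x') := by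
      simp_rw [Finset.mul_sum, ← Finset.sum_add_distrib]
      exact Finset.sum_congr rfl fun x _ => Finset.sum_congr rfl fun x' _ => by ring
    rw [this]; linarith
  have := add_nonneg (key u v huv) (key v u hvu)
  simpa only [testFun, Finset.sum_add_distrib] using this

/-- The exponent `10 = 15 - 5` is the rarity of a level set minus the growth of `testFun` on it; the
right side is chosen to telescope. The fourth-order term of the exponential suffices. -/
theorem exp_neg_ten_mul_sqrt_le (j : ℕ) :
    Real.exp (-(10 * √((j : ℝ) + 1))) ≤ 1 / 200 * (1 / ((j : ℝ) + 1) - 1 / ((j : ℝ) + 2)) := by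
  set y := √((j : ℝ) + 1) with hy
  have hy2 : y ^ 2 = (j : ℝ) + 1 := Real.sq_sqrt (by positivity)
  have hy0 : 0 ≤ y := Real.sqrt_nonneg _
  have h1 : (10 * y) ^ 4 / 24 ≤ Real.exp (10 * y) := by
    have := Real.pow_div_factorial_le_exp (10 * y) (by positivity) 4
    simpa [Nat.factorial] using this
  have hj : (0 : ℝ) ≤ j := Nat.cast_nonneg j
  have e : 1 / ((j : ℝ) + 1) - 1 / ((j : ℝ) + 2) = 1 / (((j : ℝ) + 1) * (j + 2)) := by
    field_simp; ring
  rw [Real.exp_neg, e, ← one_div, one_div_mul_one_div_rev, mul_comm (((j : ℝ) + 1) * (j + 2))]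
  apply one_div_le_one_div_of_le (by positivity)
  have h2 : (10 * y) ^ 4 / 24 = 10000 / 24 * ((j : ℝ) + 1) ^ 2 := by
    rw [← hy2]; ring
  nlinarith

/-- The geometric lemma of the book algorithm. -/
theorem exists_level {α : Type*} (X : Finset α) (hX : X.Nonempty) (u v : α → α → ℝ)
    (huv : ∀ n : ℕ, 0 ≤ ∑ x ∈ X, ∑ x' ∈ X, u x x' * v x x' ^ n)
    (hvu : ∀ n : ℕ, 0 ≤ ∑ x ∈ X, ∑ x' ∈ X, v x x' * u x x' ^ n) :
    ∃ l : ℝ, -1 ≤ l ∧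
      (Real.exp (-(15 * √(l + 2))) * (X.card : ℝ) ^ 2
          ≤ (((X ×ˢ X).filter fun p => l ≤ u p.1 p.2 ∧ -1 ≤ v p.1 p.2).card : ℝ) ∨
        Real.exp (-(15 * √(l + 2))) * (X.card : ℝ) ^ 2
          ≤ (((X ×ˢ X).filter fun p => l ≤ v p.1 p.2 ∧ -1 ≤ u p.1 p.2).card : ℝ)) := by
  classical
  by_contra! hcon
  set N : ℝ := (X.card : ℝ) ^ 2 with hN
  have hNpos : 0 < N := by have := hX.card_pos; positivity
  set P := X ×ˢ X with hP
  have hPN : (P.card : ℝ) = N := by simp [hP, hN, Finset.card_product, sq]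
  set w : α × α → ℝ := fun p => max (u p.1 p.2) (v p.1 p.2) with hw
  set Gd := P.filter fun p => -1 ≤ u p.1 p.2 ∧ -1 ≤ v p.1 p.2 with hGd
  -- The negated conclusion is a tail bound for `max u v` on the good pairs, where both kernels are
  -- at least `-1`.
  have hlev : ∀ l : ℝ, -1 ≤ l →
      ((Gd.filter fun p => l ≤ w p).card : ℝ) ≤ 2 * Real.exp (-(15 * √(l + 2))) * N := by
    intro l hl
    obtain ⟨h1, h2⟩ := hcon l hl
    have hsub : (Gd.filter fun p => l ≤ w p) ⊆
        (P.filter fun p => l ≤ u p.1 p.2 ∧ -1 ≤ v p.1 p.2) ∪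
        (P.filter fun p => l ≤ v p.1 p.2 ∧ -1 ≤ u p.1 p.2) := by
      intro p hp
      simp only [hGd, hw, Finset.mem_filter, Finset.mem_union, le_max_iff] at hp ⊢
      tauto
    have := (Finset.card_le_card hsub).trans (Finset.card_union_le _ _)
    have := (Nat.cast_le (α := ℝ)).2 this
    push_cast at this
    linarith
  have hsum : 0 ≤ ∑ p ∈ P, testFun (6 * u p.1 p.2) (6 * v p.1 p.2) := by
    rw [hP, Finset.sum_product]
    -- Scaling by `6` moves the threshold `-6` of `testFun` to `-1`.
    have hscale : ∀ u v : α → α → ℝ, (∀ n : ℕ, 0 ≤ ∑ x ∈ X, ∑ x' ∈ X, u x x' * v x x' ^ n) →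
        ∀ n : ℕ, 0 ≤ ∑ x ∈ X, ∑ x' ∈ X, (6 * u x x') * (6 * v x x') ^ n := by
      intro u v h n
      have : ∑ x ∈ X, ∑ x' ∈ X, (6 * u x x') * (6 * v x x') ^ n
          = 6 * 6 ^ n * ∑ x ∈ X, ∑ x' ∈ X, u x x' * v x x' ^ n := by
        simp_rw [Finset.mul_sum, mul_pow]
        exact Finset.sum_congr rfl fun x _ => Finset.sum_congr rfl fun x' _ => by ring
      rw [this]; exact mul_nonneg (by positivity) (h n)
    exact sum_testFun_nonneg X (fun x x' => 6 * u x x') (fun x x' => 6 * v x x')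
      (hscale u v huv) (hscale v u hvu)
  have hsplit := Finset.sum_filter_add_sum_filter_not P
    (fun p => -1 ≤ u p.1 p.2 ∧ -1 ≤ v p.1 p.2)
    (fun p => testFun (6 * u p.1 p.2) (6 * v p.1 p.2))
  have hbad : ∑ p ∈ P.filter (fun p => ¬ (-1 ≤ u p.1 p.2 ∧ -1 ≤ v p.1 p.2)),
      testFun (6 * u p.1 p.2) (6 * v p.1 p.2) ≤ -(N - Gd.card) := by
    have h1 : ∀ p ∈ P.filter (fun p => ¬ (-1 ≤ u p.1 p.2 ∧ -1 ≤ v p.1 p.2)),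
        testFun (6 * u p.1 p.2) (6 * v p.1 p.2) ≤ -1 := by
      intro p hp
      rw [Finset.mem_filter, not_and_or, not_le, not_le] at hp
      rcases hp.2 with h | h
      · exact testFun_le_neg_one (by linarith)
      · rw [testFun_comm]; exact testFun_le_neg_one (by linarith)
    have h2 := Finset.sum_le_card_nsmul _ _ _ h1
    have h3 := Finset.card_filter_add_card_filter_not (s := P)
      (fun p => -1 ≤ u p.1 p.2 ∧ -1 ≤ v p.1 p.2)
    have h4 : (Gd.card : ℝ) + ((P.filter
      (fun p => ¬ (-1 ≤ u p.1 p.2 ∧ -1 ≤ v p.1 p.2))).card : ℝ) = N := by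
      rw [← hPN, ← h3, Nat.cast_add]
    rw [nsmul_eq_mul] at h2
    linarith
  have hgood : ∑ p ∈ Gd, testFun (6 * u p.1 p.2) (6 * v p.1 p.2) ≤ 24 / 200 * N := by
    -- Good pairs are sliced by the integer part of `max u v + 1`; slice `i` is controlled by the
    -- tail bound at level `i - 1`.
    set j : α × α → ℕ := fun p => ⌊w p + 1⌋₊ with hj
    obtain ⟨J, hJ⟩ : ∃ J : ℕ, ∀ p ∈ Gd, j p < J :=
      ⟨Gd.sup j + 1, fun p hp => Nat.lt_succ_of_le (Finset.le_sup (f := j) hp)⟩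
    have hw1 : ∀ p ∈ Gd, -1 ≤ w p := fun p hp => by
      rw [hGd, Finset.mem_filter] at hp
      exact hp.2.1.trans (le_max_left _ _)
    calc ∑ p ∈ Gd, testFun (6 * u p.1 p.2) (6 * v p.1 p.2)
        ≤ ∑ p ∈ Gd, 12 * Real.exp (5 * √((j p : ℝ) + 1)) := by
          refine Finset.sum_le_sum fun p hp => ?_
          refine (testFun_le_exp (w := w p) (le_max_left _ _) (le_max_right _ _)
            (hw1 p hp)).trans ?_
          have := (Nat.lt_floor_add_one (w p + 1)).le
          gcongr
      _ = ∑ i ∈ Finset.range J, ∑ p ∈ Gd.filter (fun p => j p = i),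
            12 * Real.exp (5 * √((j p : ℝ) + 1)) :=
          (Finset.sum_fiberwise_of_maps_to (fun p hp => Finset.mem_range.2 (hJ p hp)) _).symm
      _ ≤ ∑ i ∈ Finset.range J, 24 / 200 * N * (1 / ((i : ℝ) + 1) - 1 / ((i : ℝ) + 2)) := by
          refine Finset.sum_le_sum fun i _ => ?_
          have h1 : ∑ p ∈ Gd.filter (fun p => j p = i), 12 * Real.exp (5 * √((j p : ℝ) + 1))
              = ((Gd.filter (fun p => j p = i)).card : ℝ) *
                (12 * Real.exp (5 * √((i : ℝ) + 1))) := by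
            rw [← nsmul_eq_mul, ← Finset.sum_const]
            refine Finset.sum_congr rfl fun p hp => ?_
            rw [(Finset.mem_filter.1 hp).2]
          have h2 : ((Gd.filter (fun p => j p = i)).card : ℝ)
              ≤ 2 * Real.exp (-(15 * √((i : ℝ) + 1))) * N := by
            have h3 := hlev ((i : ℝ) - 1) (by linarith [Nat.cast_nonneg (α := ℝ) i])
            rw [show (i : ℝ) - 1 + 2 = i + 1 by ring] at h3
            refine le_trans ?_ h3
            refine Nat.cast_le.2 ?_
            refine Finset.card_le_card fun p hp => ?_
            rw [Finset.mem_filter] at hp ⊢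
            refine ⟨hp.1, ?_⟩
            have h4 := Nat.floor_le (show 0 ≤ w p + 1 by linarith [hw1 p hp.1])
            have h5 : (⌊w p + 1⌋₊ : ℝ) = i := by exact_mod_cast hp.2
            linarith
          rw [h1]
          calc _ ≤ (2 * Real.exp (-(15 * √((i : ℝ) + 1))) * N) *
                (12 * Real.exp (5 * √((i : ℝ) + 1))) := by gcongr
            _ = 24 * N * Real.exp (-(10 * √((i : ℝ) + 1))) := by
                rw [show -(10 * √((i : ℝ) + 1)) = -(15 * √((i : ℝ) + 1)) + 5 * √((i : ℝ) + 1) by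
                  ring, Real.exp_add]
                ring
            _ ≤ 24 * N * (1 / 200 * (1 / ((i : ℝ) + 1) - 1 / ((i : ℝ) + 2))) := by
                gcongr
                exact exp_neg_ten_mul_sqrt_le i
            _ = _ := by ring
      _ = 24 / 200 * N * (1 - 1 / ((J : ℝ) + 1)) := by
          rw [← Finset.mul_sum]
          congr 1
          have := Finset.sum_range_sub' (fun i : ℕ => 1 / ((i : ℝ) + 1)) J
          push_cast at this
          simp only [add_assoc] at this
          norm_num at this ⊢
          linarith
      _ ≤ 24 / 200 * N * 1 := by
          gcongr
          have : (0 : ℝ) ≤ 1 / ((J : ℝ) + 1) := by positivity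
          linarith
      _ = _ := by ring
  -- At level `-1` every good pair is counted, so at least `3/4` of the pairs are bad and contribute
  -- at most `-1` each. This outweighs the `24 / 200` from the good ones and contradicts `hsum`.
  have hGdcard : (Gd.card : ℝ) ≤ 1 / 4 * N := by
    have h1 := hlev (-1) le_rfl
    have h2 : Gd.filter (fun p => -1 ≤ w p) = Gd := by
      refine Finset.filter_true_of_mem fun p hp => ?_
      rw [hGd, Finset.mem_filter] at hp
      exact hp.2.1.trans (le_max_left _ _)
    rw [h2, show (-1 : ℝ) + 2 = 1 by norm_num, Real.sqrt_one, Real.exp_neg] at h1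
    have h3 : (8 : ℝ) ≤ Real.exp (15 * 1) := by linarith [Real.add_one_le_exp (15 * 1 : ℝ)]
    have h4 : (Real.exp (15 * 1))⁻¹ ≤ 1 / 8 := by
      rw [← one_div]; exact one_div_le_one_div_of_le (by norm_num) h3
    nlinarith
  rw [← hsplit] at hsum
  linarith

/-! ### Neighbourhoods and the choice of a pivot. -/

open Classical in
/-- The neighbours of `x` inside `Y`. -/
noncomputable def nbhd {V : Type*} (G : SimpleGraph V) (x : V) (Y : Finset V) : Finset V :=
  Y.filter (G.Adj x)

theorem mem_nbhd {V : Type*} {G : SimpleGraph V} {x y : V} {Y : Finset V} :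
    y ∈ nbhd G x Y ↔ y ∈ Y ∧ G.Adj x y := by
  classical
  simp [nbhd]

theorem nbhd_subset {V : Type*} (G : SimpleGraph V) (x : V) (Y : Finset V) : nbhd G x Y ⊆ Y :=
  fun _ h => (mem_nbhd.1 h).1

/-- The covariance of two `D`-subsets of `Y` with respect to the mean density. -/
theorem sum_indicator_sub_mul {V : Type*} [DecidableEq V] {Y M N : Finset V} (hM : M ⊆ Y)
    (hN : N ⊆ Y) {D : ℕ} (hMD : M.card = D) (hND : N.card = D) (hY : Y.Nonempty) :
    ∑ y ∈ Y, ((if y ∈ M then (1 : ℝ) else 0) - D / Y.card)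
        * ((if y ∈ N then (1 : ℝ) else 0) - D / Y.card)
      = ((M ∩ N).card : ℝ) - D / Y.card * D := by
  have hY0 : (Y.card : ℝ) ≠ 0 := by exact_mod_cast hY.card_ne_zero
  have h1 : ∀ y ∈ Y, ((if y ∈ M then (1 : ℝ) else 0) - D / Y.card)
        * ((if y ∈ N then (1 : ℝ) else 0) - D / Y.card)
      = (if y ∈ M ∩ N then (1 : ℝ) else 0) - D / Y.card * (if y ∈ M then (1 : ℝ) else 0)
        - D / Y.card * (if y ∈ N then (1 : ℝ) else 0) + (D / Y.card) ^ 2 := by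
    intro y _
    by_cases h1 : y ∈ M <;> by_cases h2 : y ∈ N <;> simp [h1, h2] <;> ring
  have hc : ∀ Z ⊆ Y, ∑ y ∈ Y, (if y ∈ Z then (1 : ℝ) else 0) = Z.card := by
    intro Z hZ
    rw [Finset.sum_ite_mem, Finset.inter_eq_right.2 hZ]
    simp
  rw [Finset.sum_congr rfl h1, Finset.sum_add_distrib, Finset.sum_sub_distrib,
    Finset.sum_sub_distrib, ← Finset.mul_sum, ← Finset.mul_sum, hc M hM, hc N hN,
    hc _ (Finset.inter_subset_left.trans hM), hMD, hND, Finset.sum_const, nsmul_eq_mul]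
  field_simp
  ring

theorem exists_fiber_card_ge {α : Type*} [DecidableEq α] {X : Finset α} (hX : X.Nonempty)
    (Q : α → α → Prop) [DecidablePred fun p : α × α => Q p.1 p.2] [∀ x, DecidablePred (Q x)]
    {r : ℝ} (h : r * (X.card : ℝ) ^ 2 ≤ (((X ×ˢ X).filter fun p => Q p.1 p.2).card : ℝ)) :
    ∃ x ∈ X, r * X.card ≤ ((X.filter fun x' => Q x x').card : ℝ) := by
  by_contra! hcon
  have h1 : (((X ×ˢ X).filter fun p => Q p.1 p.2).card : ℝ)
      = ∑ x ∈ X, ((X.filter fun x' => Q x x').card : ℝ) := by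
    simp only [Finset.card_filter, Finset.sum_product]
    push_cast
    rfl
  have h2 := Finset.sum_lt_sum_of_nonempty hX hcon
  rw [Finset.sum_const, nsmul_eq_mul] at h2
  rw [h1] at h
  nlinarith

/-- The step of the book algorithm: a pivot `x`, whose neighbourhoods `Y' c` in `Y c` retain the
densities up to `α c`, and in some colour gain `l * α`, on a large part `X'` of `X`. -/
theorem exists_pivot {V : Type*} (H : Bool → SimpleGraph V) {X : Finset V} (hX : X.Nonempty)
    {Y : Bool → Finset V} (hY : ∀ c, (Y c).Nonempty) {p α : Bool → ℝ} (hp : ∀ c, 0 < p c)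
    (hα : ∀ c, 0 < α c)
    (hdeg : ∀ c, ∀ x ∈ X, p c * (Y c).card ≤ ((nbhd (H c) x (Y c)).card : ℝ)) :
    ∃ x ∈ X, ∃ X' ⊆ X, ∃ Y' : Bool → Finset V,
      (∀ c, Y' c ⊆ nbhd (H c) x (Y c) ∧ p c * (Y c).card ≤ ((Y' c).card : ℝ)) ∧
      ∃ a : Bool, ∃ l : ℝ, -1 ≤ l ∧
        Real.exp (-(15 * √(l + 2))) * X.card ≤ X'.card ∧
        (∀ x' ∈ X', (p a + l * α a) * (Y' a).card ≤ ((nbhd (H a) x' (Y' a)).card : ℝ)) ∧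
        ∀ c, ∀ x' ∈ X', (p c - α c) * (Y' c).card ≤ ((nbhd (H c) x' (Y' c)).card : ℝ) := by
  classical
  -- Neighbourhoods are trimmed to a common size `D c`, so that the covariance of two of them
  -- depends only on their intersection.
  set D : Bool → ℕ := fun c => ⌈p c * (Y c).card⌉₊ with hD
  have hDpos : ∀ c, 0 < D c := fun c => Nat.ceil_pos.2 (mul_pos (hp c)
    (by exact_mod_cast (hY c).card_pos))
  have hDp : ∀ c, p c ≤ D c / (Y c).card := fun c => by
    rw [le_div_iff₀ (by exact_mod_cast (hY c).card_pos)]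
    exact Nat.le_ceil _
  have hex : ∀ c x, ∃ N : Finset V, x ∈ X → N ⊆ nbhd (H c) x (Y c) ∧ N.card = D c := by
    intro c x
    by_cases hx : x ∈ X
    · obtain ⟨N, h1, h2⟩ := Finset.exists_subset_card_eq (Nat.ceil_le.2 (hdeg c x hx))
      exact ⟨N, fun _ => ⟨h1, h2⟩⟩
    · exact ⟨∅, fun h => absurd h hx⟩
  choose N hN using hex
  set a : Bool → V → V → ℝ := fun c x y => (if y ∈ N c x then (1 : ℝ) else 0) - D c / (Y c).card
    with ha
  -- Normalised so that `l ≤ u c x x'` means that `N c x'` has density at least `D c / |Y c| + l * α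
  -- c` inside `N c x`.
  set u : Bool → V → V → ℝ := fun c x x' =>
    (α c * D c)⁻¹ * ∑ y ∈ Y c, a c x y * a c x' y with hu
  have hpos : ∀ c, 0 < α c * D c := fun c => mul_pos (hα c) (by exact_mod_cast hDpos c)
  have hgram : ∀ c d, ∀ n : ℕ, 0 ≤ ∑ x ∈ X, ∑ x' ∈ X, u c x x' * u d x x' ^ n := by
    intro c d n
    have h1 := sum_gram_mul_gram_pow_nonneg X (Y c) (Y d) (a c) (a d) n
    have h2 : ∑ x ∈ X, ∑ x' ∈ X, u c x x' * u d x x' ^ n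
        = (α c * D c)⁻¹ * (α d * D d)⁻¹ ^ n * ∑ x ∈ X, ∑ x' ∈ X,
          (∑ y ∈ Y c, a c x y * a c x' y) * (∑ z ∈ Y d, a d x z * a d x' z) ^ n := by
      simp_rw [Finset.mul_sum X, hu, mul_pow]
      exact Finset.sum_congr rfl fun x _ => Finset.sum_congr rfl fun x' _ => by ring
    rw [h2]
    have := hpos c
    have := hpos d
    exact mul_nonneg (by positivity) h1
  have hcard : ∀ c, ∀ l : ℝ, ∀ x ∈ X, ∀ x' ∈ X, l ≤ u c x x' →
      (p c + l * α c) * (N c x).card ≤ ((nbhd (H c) x' (N c x)).card : ℝ) := by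
    intro c l x hx x' hx' hl
    obtain ⟨h1, h2⟩ := hN c x hx
    obtain ⟨h3, h4⟩ := hN c x' hx'
    have h5 := sum_indicator_sub_mul (h1.trans (nbhd_subset _ _ _)) (h3.trans (nbhd_subset _ _ _))
      h2 h4 (hY c)
    have h6 : l * (α c * D c) ≤ ((N c x ∩ N c x').card : ℝ) - D c / (Y c).card * D c := by
      rw [← h5]
      simp only [hu] at hl
      rwa [← div_eq_inv_mul, le_div_iff₀ (hpos c)] at hl
    have h7 : N c x ∩ N c x' ⊆ nbhd (H c) x' (N c x) := fun y hy => by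
      rw [Finset.mem_inter] at hy
      exact mem_nbhd.2 ⟨hy.1, (mem_nbhd.1 (h3 hy.2)).2⟩
    have h8 : ((N c x ∩ N c x').card : ℝ) ≤ ((nbhd (H c) x' (N c x)).card : ℝ) := by
      exact_mod_cast Finset.card_le_card h7
    have h9 : p c * D c ≤ D c / (Y c).card * D c :=
      mul_le_mul_of_nonneg_right (hDp c) (Nat.cast_nonneg _)
    rw [h2]
    linarith
  obtain ⟨l, hl, h⟩ := exists_level X hX (u true) (u false) (hgram _ _) (hgram _ _)
  have key : ∃ c : Bool, Real.exp (-(15 * √(l + 2))) * (X.card : ℝ) ^ 2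
      ≤ (((X ×ˢ X).filter fun q => l ≤ u c q.1 q.2 ∧ -1 ≤ u (!c) q.1 q.2).card : ℝ) := by
    rcases h with h | h
    · exact ⟨true, h⟩
    · exact ⟨false, h⟩
  obtain ⟨c, hc⟩ := key
  obtain ⟨x, hx, hx2⟩ := exists_fiber_card_ge hX
    (fun x x' => l ≤ u c x x' ∧ -1 ≤ u (!c) x x') hc
  refine ⟨x, hx, X.filter fun x' => l ≤ u c x x' ∧ -1 ≤ u (!c) x x', Finset.filter_subset _ _,
    fun d => N d x, fun d => ⟨(hN d x hx).1, ?_⟩, c, l, hl, hx2, fun x' hx' => ?_,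
    fun d x' hx' => ?_⟩
  · simp only [(hN d x hx).2]
    exact Nat.le_ceil _
  · rw [Finset.mem_filter] at hx'
    exact hcard c l x hx x' hx'.1 hx'.2.1
  · rw [Finset.mem_filter] at hx'
    have h1 : -1 ≤ u d x x' := by
      rcases Bool.eq_or_eq_not d c with rfl | rfl
      · exact hl.trans hx'.2.1
      · exact hx'.2.2
    have := hcard d (-1) x hx x' hx'.1 h1
    rwa [neg_one_mul, ← sub_eq_add_neg] at this

/-! ### Clique bounds and the Erdős–Szekeres bound. -/

/-- Every pair of vertices has at least one of the two colours. -/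
def IsColouring {V : Type*} (H : Bool → SimpleGraph V) : Prop :=
  ∀ x y, x ≠ y → ∃ c, (H c).Adj x y

theorem card_le_sum_nbhd {V : Type*} {H : Bool → SimpleGraph V} (hH : IsColouring H) (x : V)
    (S : Finset V) :
    (S.card : ℝ) - 1 ≤ ((nbhd (H true) x S).card : ℝ) + ((nbhd (H false) x S).card : ℝ) := by
  classical
  have h : S ⊆ insert x (nbhd (H true) x S ∪ nbhd (H false) x S) := by
    intro y hy
    by_cases hxy : x = y
    · simp [hxy]
    · obtain ⟨c, hc⟩ := hH x y hxy
      rw [Finset.mem_insert, Finset.mem_union]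
      cases c
      · exact Or.inr (Or.inr (mem_nbhd.2 ⟨hy, hc⟩))
      · exact Or.inr (Or.inl (mem_nbhd.2 ⟨hy, hc⟩))
  have h1 := (Finset.card_le_card h).trans (Finset.card_insert_le _ _)
  have h2 := Finset.card_union_le (nbhd (H true) x S) (nbhd (H false) x S)
  have h3 : S.card ≤ (nbhd (H true) x S).card + (nbhd (H false) x S).card + 1 := by omega
  have h4 := (Nat.cast_le (α := ℝ)).2 h3
  push_cast at h4
  linarith

/-- All cliques of colour `c` inside `S` have at most `m` vertices. -/
def CliqueBound {V : Type*} (G : SimpleGraph V) (S : Finset V) (m : ℕ) : Prop :=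
  ∀ K ⊆ S, G.IsClique (K : Set V) → K.card ≤ m

theorem CliqueBound.mono {V : Type*} {G : SimpleGraph V} {S T : Finset V} {m : ℕ}
    (h : CliqueBound G S m) (hT : T ⊆ S) : CliqueBound G T m :=
  fun K hK => h K (hK.trans hT)

/-- A clique complete to `S'` lowers the clique bound in `S'`. -/
theorem CliqueBound.of_join {V : Type*} {G : SimpleGraph V} {S T S' : Finset V} {m t : ℕ}
    (h : CliqueBound G S (m + t)) (hT : T ⊆ S) (hTc : G.IsClique (T : Set V)) (ht : t ≤ T.card)
    (hS' : S' ⊆ S) (hj : ∀ x ∈ T, ∀ y ∈ S', G.Adj x y) : CliqueBound G S' m := by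
  classical
  intro K hK hKc
  have hdisj : Disjoint T K := Finset.disjoint_left.2 fun x hx hx' =>
    G.loopless.irrefl x (hj x hx x (hK hx'))
  have h1 := h (T ∪ K) (Finset.union_subset hT (hK.trans hS')) (by
    rw [Finset.coe_union]
    intro x hx y hy hxy
    rcases hx with hx | hx <;> rcases hy with hy | hy
    · exact hTc hx hy hxy
    · exact hj x hx y (hK hy)
    · exact (hj y hy x (hK hx)).symm
    · exact hKc hx hy hxy)
  rw [Finset.card_union_of_disjoint hdisj] at h1
  omega

theorem CliqueBound.nbhd {V : Type*} {G : SimpleGraph V} {S : Finset V} {m : ℕ} {x : V}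
    (h : CliqueBound G S (m + 1)) (hx : x ∈ S) : CliqueBound G (nbhd G x S) m :=
  h.of_join (T := {x}) (by simpa using hx) (by simp) (by simp) (nbhd_subset _ _ _) (by
    simp only [Finset.mem_singleton]
    rintro _ rfl y hy
    exact (mem_nbhd.1 hy).2)

/-- The Erdős–Szekeres bound. -/
theorem card_lt_choose {V : Type*} {H : Bool → SimpleGraph V} (hH : IsColouring H) (a b : ℕ)
    (S : Finset V) (ha : CliqueBound (H true) S a) (hb : CliqueBound (H false) S b) :
    S.card < (a + b + 2).choose (a + 1) := by
  have h0 : ∀ G : SimpleGraph V, ∀ S : Finset V, CliqueBound G S 0 → S = ∅ := by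
    intro G S h
    by_contra hne
    obtain ⟨x, hx⟩ := Finset.nonempty_iff_ne_empty.2 hne
    have := h {x} (by simpa using hx) (by simp)
    simp at this
  rcases S.eq_empty_or_nonempty with rfl | ⟨x, hx⟩
  · simpa using Nat.choose_pos (by omega : a + 1 ≤ a + b + 2)
  induction hs : a + b generalizing a b S x with
  | zero =>
    obtain rfl : a = 0 := by omega
    simp [h0 _ _ ha] at hx
  | succ s ih =>
    have hcard : S.card ≤ (nbhd (H true) x S).card + (nbhd (H false) x S).card + 1 := by
      have := card_le_sum_nbhd hH x S
      have h2 : (S.card : ℝ)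
          ≤ (((nbhd (H true) x S).card + (nbhd (H false) x S).card + 1 : ℕ) : ℝ) := by
        push_cast; linarith
      exact_mod_cast h2
    rcases a with _ | a
    · simp [h0 _ _ ha] at hx
    rcases b with _ | b
    · simp [h0 _ _ hb] at hx
    have key : ∀ a b : ℕ, ∀ T : Finset V, CliqueBound (H true) T a → CliqueBound (H false) T b →
        a + b = s → T.card < (s + 2).choose (a + 1) := by
      intro a b T h1 h2 h3
      rcases T.eq_empty_or_nonempty with rfl | ⟨y, hy⟩
      · simpa using Nat.choose_pos (by omega : a + 1 ≤ s + 2)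
      · exact ih a b T h1 h2 y hy h3
    have h1 := key a (b + 1) _ (ha.nbhd hx) (hb.mono (nbhd_subset _ _ _)) (by omega)
    have h2 := key (a + 1) b _ (ha.mono (nbhd_subset _ _ _)) (hb.nbhd hx) (by omega)
    have h3 : (s + 1 + 2).choose (a + 1 + 1)
        = (s + 2).choose (a + 1) + (s + 2).choose (a + 1 + 1) :=
      Nat.choose_succ_succ _ _
    omega

/-- Binomial coefficients away from the centre. -/
theorem choose_le_exp (N j : ℕ) (hj : j ≤ N) (h : ℝ) :
    (N.choose j : ℝ) ≤ 2 ^ N * Real.exp (N * h ^ 2 / 2 - h * (N - 2 * j)) := by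
  -- A Chernoff bound: one term of the binomial expansion of `(e^(-h) + e^h) ^ N`, together with
  -- `cosh h ≤ exp (h ^ 2 / 2)`.
  have h1 : (N.choose j : ℝ) * Real.exp (h * (N - 2 * j)) ≤ (Real.exp (-h) + Real.exp h) ^ N := by
    rw [add_pow]
    refine le_trans (le_of_eq ?_) (Finset.single_le_sum (f := fun i : ℕ =>
      Real.exp (-h) ^ i * Real.exp h ^ (N - i) * (N.choose i : ℝ))
      (fun i _ => by positivity) (Finset.mem_range.2 (Nat.lt_succ_of_le hj)))
    rw [← Real.exp_nat_mul, ← Real.exp_nat_mul, ← Real.exp_add, mul_comm]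
    congr 2
    push_cast [Nat.cast_sub hj]
    ring
  have h2 : (Real.exp (-h) + Real.exp h) ^ N ≤ 2 ^ N * Real.exp (N * h ^ 2 / 2) := by
    have h3 : Real.exp (-h) + Real.exp h = 2 * Real.cosh h := by rw [Real.cosh_eq]; ring
    rw [h3, mul_pow, show (N : ℝ) * h ^ 2 / 2 = N * (h ^ 2 / 2) by ring, Real.exp_nat_mul]
    have := Real.cosh_le_exp_half_sq h
    have h4 : 0 ≤ Real.cosh h := (Real.cosh_pos h).le
    gcongr
  rw [Real.exp_sub, mul_div_assoc', le_div_iff₀ (Real.exp_pos _)]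
  exact h1.trans h2

/-! ### The book algorithm. -/

/-- The parameters of the book algorithm: `t` is the size of the spine, `p` the guaranteed density,
`δ` the initial slack, `L` the threshold for density increments, `A` the price of an increment. -/
structure BookParams (t : ℕ) (p δ L A : ℝ) : Prop where
  two_le : 2 ≤ t
  p_pos : 0 < p
  δ_pos : 0 < δ
  L_nonneg : 0 < L
  A_nonneg : 0 ≤ A
  price : ∀ l, L ≤ l → l ≤ 8 * t / δ → 15 * √(l + 2) ≤ A * Real.log (1 + l / t)

/-- The loss in `log |X|` of a colour step. -/
noncomputable def stepLoss (t : ℕ) (L A : ℝ) : ℝ := 15 * √(L + 2) + Real.log 4 + 2 * A / t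

/-- A state of the book algorithm: spines `T c`, pages `Y c`, reservoir `X`, slacks `q c`, numbers
`e c` of density increments. -/
structure BookState {V : Type*} (H : Bool → SimpleGraph V) (S : Finset V) (t : ℕ) (p δ L A : ℝ)
    (X : Finset V) (Y T : Bool → Finset V) (q : Bool → ℝ) (e : Bool → ℕ) : Prop where
  X_sub : X ⊆ S
  X_pos : X.Nonempty
  Y_sub : ∀ c, Y c ⊆ S
  T_sub : ∀ c, T c ⊆ S
  T_clique : ∀ c, (H c).IsClique (T c : Set V)
  T_X : ∀ c, ∀ x ∈ T c, ∀ y ∈ X, (H c).Adj x y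
  T_Y : ∀ c, ∀ x ∈ T c, ∀ y ∈ Y c, (H c).Adj x y
  T_card : ∀ c, (T c).card ≤ t
  q_pos : ∀ c, 0 < q c
  deg : ∀ c, ∀ x ∈ X, (p + q c) * (Y c).card ≤ ((nbhd (H c) x (Y c)).card : ℝ)
  Y_card : ∀ c, p ^ ((T c).card + e c) * S.card ≤ ((Y c).card : ℝ)
  log_q : ∀ c, Real.log δ - 2 / t * (T c).card + e c * Real.log (1 + L / t) ≤ Real.log (q c)
  -- The potential is `log |X| + A (log q true + log q false)`. Increments never decrease it, since
  -- the rise of `log q` pays for the lost vertices of `X`; a colour step costs at most `stepLoss`.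
  log_X : Real.log S.card - stepLoss t L A * (((T true).card : ℝ) + (T false).card)
    - A * (Real.log (q true) + Real.log (q false) - 2 * Real.log δ) ≤ Real.log X.card

section

variable {V : Type*} {H : Bool → SimpleGraph V} {S : Finset V} {t : ℕ} {p δ L A : ℝ}
  {X : Finset V} {Y T : Bool → Finset V} {q : Bool → ℝ} {e : Bool → ℕ}

theorem BookState.Y_pos (hs : BookState H S t p δ L A X Y T q e) (hP : BookParams t p δ L A)
    (c : Bool) : (Y c).Nonempty := by
  have h1 : 0 < S.card := (hs.X_pos.mono hs.X_sub).card_pos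
  have h2 := hs.Y_card c
  have h3 := hP.p_pos
  have h4 : (0 : ℝ) < (Y c).card := lt_of_lt_of_le (by positivity) h2
  exact Finset.card_pos.1 (by exact_mod_cast h4)

theorem density_le_one {G : SimpleGraph V} {x : V} {Z : Finset V} {r : ℝ} (hZ : Z.Nonempty)
    (h : r * Z.card ≤ ((nbhd G x Z).card : ℝ)) : r ≤ 1 := by
  have h1 : ((nbhd G x Z).card : ℝ) ≤ Z.card := by
    exact_mod_cast Finset.card_le_card (nbhd_subset _ _ _)
  have h2 : (0 : ℝ) < Z.card := by exact_mod_cast hZ.card_pos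
  by_contra! hr
  nlinarith

theorem BookState.q_le_one (hs : BookState H S t p δ L A X Y T q e) (hP : BookParams t p δ L A)
    (c : Bool) : q c ≤ 1 := by
  obtain ⟨x, hx⟩ := hs.X_pos
  linarith [density_le_one (hs.Y_pos hP c) (hs.deg c x hx), hP.p_pos]

/-- At most `t` colour steps in one colour lower `log q` by at most `2 / t` each, and `e ^ 2 < 8`.
-/
theorem BookState.le_q (hs : BookState H S t p δ L A X Y T q e) (hP : BookParams t p δ L A)
    (c : Bool) : δ / 8 ≤ q c := by
  have ht : (0 : ℝ) < t := by exact_mod_cast (show 0 < t by linarith [hP.two_le])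
  have h1 := hs.log_q c
  have h2 : 2 / (t : ℝ) * (T c).card ≤ 2 := by
    rw [div_mul_eq_mul_div, div_le_iff₀ ht]
    have : ((T c).card : ℝ) ≤ t := by exact_mod_cast hs.T_card c
    linarith
  have h3 : 0 ≤ (e c : ℝ) * Real.log (1 + L / t) :=
    mul_nonneg (Nat.cast_nonneg _) (Real.log_nonneg (by
      have := hP.L_nonneg
      have : 0 ≤ L / t := by positivity
      linarith))
  have h4 : Real.log δ - 2 ≤ Real.log (q c) := by linarith
  have h5 := Real.exp_le_exp.2 h4
  rw [Real.exp_sub, Real.exp_log hP.δ_pos, Real.exp_log (hs.q_pos c)] at h5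
  refine le_trans (div_le_div_of_nonneg_left hP.δ_pos.le (Real.exp_pos _) ?_) h5
  have h6 := Real.exp_one_lt_d9
  have h7 : Real.exp 2 = Real.exp 1 * Real.exp 1 := by rw [← Real.exp_add]; norm_num
  nlinarith [Real.exp_pos 1]

theorem BookState.increments_le (hs : BookState H S t p δ L A X Y T q e)
    (hP : BookParams t p δ L A) (c : Bool) :
    (e c : ℝ) * Real.log (1 + L / t) ≤ 2 - Real.log δ := by
  have ht : (0 : ℝ) < t := by exact_mod_cast (show 0 < t by linarith [hP.two_le])
  have h1 := hs.log_q c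
  have h2 : 2 / (t : ℝ) * (T c).card ≤ 2 := by
    rw [div_mul_eq_mul_div, div_le_iff₀ ht]
    have : ((T c).card : ℝ) ≤ t := by exact_mod_cast hs.T_card c
    linarith
  have h3 := Real.log_nonpos (hs.q_pos c).le (hs.q_le_one hP c)
  linarith

theorem neg_two_div_le_log {t : ℕ} (ht : 2 ≤ t) : -(2 / (t : ℝ)) ≤ Real.log (1 - 1 / t) := by
  have ht' : (2 : ℝ) ≤ t := by exact_mod_cast ht
  have h0 : 0 < 1 - 1 / (t : ℝ) := by
    rw [sub_pos, div_lt_one (by linarith)]; linarith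
  have h1 := Real.one_sub_inv_le_log_of_pos h0
  refine le_trans ?_ h1
  have h2 : 1 - (1 - 1 / (t : ℝ))⁻¹ = -(1 / (t - 1)) := by
    have : (t : ℝ) - 1 ≠ 0 := by linarith
    have : (t : ℝ) ≠ 0 := by linarith
    field_simp
    ring
  rw [h2, neg_le_neg_iff, div_le_div_iff₀ (by linarith) (by linarith)]
  linarith

/-- A colour step: the pivot joins the spine of colour `j`. -/
theorem BookState.colour_step [DecidableEq V] (hs : BookState H S t p δ L A X Y T q e)
    (hP : BookParams t p δ L A) {j : Bool} (hj : (T j).card < t) {x : V} (hx : x ∈ X)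
    {X' : Finset V} (hX' : X' ⊆ X) (hne : X'.Nonempty) (hxX' : ∀ y ∈ X', (H j).Adj x y)
    {Z : Finset V} (hZ : Z ⊆ nbhd (H j) x (Y j)) (hZc : (p + q j) * (Y j).card ≤ (Z.card : ℝ))
    (hdeg : ∀ x' ∈ X', (p + q j - q j / t) * Z.card ≤ ((nbhd (H j) x' Z).card : ℝ))
    (hcard : Real.log X.card - (15 * √(L + 2) + Real.log 4) ≤ Real.log X'.card) :
    BookState H S t p δ L A X' (Function.update Y j Z) (Function.update T j (insert x (T j)))
      (Function.update q j (q j * (1 - 1 / t))) e := by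
  have ht : (2 : ℝ) ≤ t := by exact_mod_cast hP.two_le
  have h1t : 0 < 1 - 1 / (t : ℝ) := by
    rw [sub_pos, div_lt_one (by linarith)]; linarith
  have hxT : x ∉ T j := fun h => (H j).loopless.irrefl x (hs.T_X j x h x hx)
  have hTc : (insert x (T j)).card = (T j).card + 1 := Finset.card_insert_of_notMem hxT
  have hlog : Real.log (q j) - 2 / t ≤ Real.log (q j * (1 - 1 / t)) := by
    rw [Real.log_mul (hs.q_pos j).ne' h1t.ne']
    linarith [neg_two_div_le_log hP.two_le]
  have hZY : Z ⊆ Y j := hZ.trans (nbhd_subset _ _ _)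
  constructor
  · exact hX'.trans hs.X_sub
  · exact hne
  · intro c
    rcases eq_or_ne c j with rfl | hc
    · simpa using hZY.trans (hs.Y_sub c)
    · simpa [hc] using hs.Y_sub c
  · intro c
    rcases eq_or_ne c j with rfl | hc
    · simpa [Finset.insert_subset_iff] using ⟨hs.X_sub hx, hs.T_sub c⟩
    · simpa [hc] using hs.T_sub c
  · intro c
    rcases eq_or_ne c j with rfl | hc
    · rw [Function.update_self, Finset.coe_insert]
      exact (hs.T_clique c).insert fun y hy _ => (hs.T_X c y hy x hx).symm
    · simpa [hc] using hs.T_clique c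
  · intro c
    rcases eq_or_ne c j with rfl | hc
    · rw [Function.update_self]
      intro z hz y hy
      rcases Finset.mem_insert.1 hz with rfl | hz
      · exact hxX' y hy
      · exact hs.T_X c z hz y (hX' hy)
    · rw [Function.update_of_ne hc]
      exact fun z hz y hy => hs.T_X c z hz y (hX' hy)
  · intro c
    rcases eq_or_ne c j with rfl | hc
    · rw [Function.update_self, Function.update_self]
      intro z hz y hy
      rcases Finset.mem_insert.1 hz with rfl | hz
      · exact (mem_nbhd.1 (hZ hy)).2
      · exact hs.T_Y c z hz y (hZY hy)
    · rw [Function.update_of_ne hc, Function.update_of_ne hc]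
      exact hs.T_Y c
  · intro c
    rcases eq_or_ne c j with rfl | hc
    · rw [Function.update_self, hTc]; omega
    · rw [Function.update_of_ne hc]; exact hs.T_card c
  · intro c
    rcases eq_or_ne c j with rfl | hc
    · rw [Function.update_self]; exact mul_pos (hs.q_pos c) h1t
    · rw [Function.update_of_ne hc]; exact hs.q_pos c
  · intro c
    rcases eq_or_ne c j with rfl | hc
    · rw [Function.update_self, Function.update_self]
      intro y hy
      refine le_trans (le_of_eq ?_) (hdeg y hy)
      ring
    · rw [Function.update_of_ne hc, Function.update_of_ne hc]
      exact fun y hy => hs.deg c y (hX' hy)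
  · intro c
    rcases eq_or_ne c j with rfl | hc
    · rw [Function.update_self, Function.update_self, hTc]
      refine le_trans ?_ hZc
      calc p ^ ((T c).card + 1 + e c) * (S.card : ℝ)
          = p * (p ^ ((T c).card + e c) * S.card) := by ring
        _ ≤ (p + q c) * (Y c).card := by
          have := hs.Y_card c
          have := hP.p_pos
          have := hs.q_pos c
          gcongr
          linarith
    · rw [Function.update_of_ne hc, Function.update_of_ne hc]
      exact hs.Y_card c
  · intro c
    rcases eq_or_ne c j with rfl | hc
    · rw [Function.update_self, Function.update_self, hTc]
      have := hs.log_q c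
      push_cast
      linarith
    · rw [Function.update_of_ne hc, Function.update_of_ne hc]
      exact hs.log_q c
  · have h1 := hs.log_X
    have h2 := mul_le_mul_of_nonneg_left hlog hP.A_nonneg
    have h3 : A * (2 / t) = 2 * A / t := by ring
    rw [mul_sub, h3] at h2
    have h4 : stepLoss t L A = 15 * √(L + 2) + Real.log 4 + 2 * A / t := rfl
    cases j
    · simp only [Function.update_self, Function.update_of_ne (show true ≠ false by simp), hTc]
      push_cast
      linarith
    · simp only [Function.update_self, Function.update_of_ne (show false ≠ true by simp), hTc]
      push_cast
      linarith

/-- A density increment in colour `j`. -/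
theorem BookState.increment_step [DecidableEq V] (hs : BookState H S t p δ L A X Y T q e)
    (hP : BookParams t p δ L A) {j : Bool} {l : ℝ} {X' : Finset V} (hX' : X' ⊆ X)
    (hne : X'.Nonempty) (hl : L ≤ l) {Z : Finset V} (hZY : Z ⊆ Y j)
    (hZc : (p + q j) * (Y j).card ≤ (Z.card : ℝ))
    (hdeg : ∀ x' ∈ X', (p + q j + l * (q j / t)) * Z.card ≤ ((nbhd (H j) x' Z).card : ℝ))
    (hcard : Real.log X.card - 15 * √(l + 2) ≤ Real.log X'.card) :
    BookState H S t p δ L A X' (Function.update Y j Z) T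
      (Function.update q j (q j * (1 + l / t))) (Function.update e j (e j + 1)) := by
  have ht : (2 : ℝ) ≤ t := by exact_mod_cast hP.two_le
  have hL := hP.L_nonneg
  have hl0 : 0 < l := by linarith
  have h1l : 0 < 1 + l / (t : ℝ) := by positivity
  have hlogL : Real.log (1 + L / t) ≤ Real.log (1 + l / t) :=
    Real.log_le_log (by positivity) (by gcongr)
  have hlog : Real.log (q j * (1 + l / t)) = Real.log (q j) + Real.log (1 + l / t) :=
    Real.log_mul (hs.q_pos j).ne' h1l.ne'
  have hZ1 : p ^ ((T j).card + (e j + 1)) * S.card ≤ (Z.card : ℝ) := by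
    refine le_trans ?_ hZc
    calc p ^ ((T j).card + (e j + 1)) * (S.card : ℝ)
        = p * (p ^ ((T j).card + e j) * S.card) := by ring
      _ ≤ (p + q j) * (Y j).card := by
        have := hs.Y_card j
        have := hP.p_pos
        have := hs.q_pos j
        gcongr
        linarith
  have hprice : 15 * √(l + 2) ≤ A * Real.log (1 + l / t) := by
    -- The new density `p + q j (1 + l / t)` is at most `1` and `q j ≥ δ / 8`, so `l ≤ 8 t / δ`.
    -- This is why `price` is only required up to there.
    refine hP.price l hl ?_
    obtain ⟨y, hy⟩ := hne
    have hSpos : (0 : ℝ) < S.card := by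
      exact_mod_cast (hs.X_pos.mono hs.X_sub).card_pos
    have hZpos : (0 : ℝ) < Z.card := lt_of_lt_of_le
      (mul_pos (pow_pos hP.p_pos _) hSpos) hZ1
    have h1 := density_le_one (Finset.card_pos.1 (by exact_mod_cast hZpos)) (hdeg y hy)
    have h2 := hs.le_q hP j
    have h3 : δ / 8 * (l / t) ≤ 1 := by
      have h4 : δ / 8 * (l / t) ≤ q j * (l / t) := by gcongr
      have h5 : q j * (l / t) = l * (q j / t) := by ring
      have := hP.p_pos
      have := hs.q_pos j
      linarith
    have h6 := hP.δ_pos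
    rw [le_div_iff₀ h6]
    rw [← mul_div_assoc, div_le_one (by linarith)] at h3
    linarith
  constructor
  · exact hX'.trans hs.X_sub
  · exact hne
  · intro c
    rcases eq_or_ne c j with rfl | hc
    · simpa using hZY.trans (hs.Y_sub c)
    · simpa [hc] using hs.Y_sub c
  · exact hs.T_sub
  · exact hs.T_clique
  · exact fun c z hz y hy => hs.T_X c z hz y (hX' hy)
  · intro c
    rcases eq_or_ne c j with rfl | hc
    · rw [Function.update_self]
      exact fun z hz y hy => hs.T_Y c z hz y (hZY hy)
    · rw [Function.update_of_ne hc]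
      exact hs.T_Y c
  · exact hs.T_card
  · intro c
    rcases eq_or_ne c j with rfl | hc
    · rw [Function.update_self]; exact mul_pos (hs.q_pos c) h1l
    · rw [Function.update_of_ne hc]; exact hs.q_pos c
  · intro c
    rcases eq_or_ne c j with rfl | hc
    · rw [Function.update_self, Function.update_self]
      intro y hy
      refine le_trans (le_of_eq ?_) (hdeg y hy)
      ring
    · rw [Function.update_of_ne hc, Function.update_of_ne hc]
      exact fun y hy => hs.deg c y (hX' hy)
  · intro c
    rcases eq_or_ne c j with rfl | hc
    · rw [Function.update_self, Function.update_self]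
      exact hZ1
    · rw [Function.update_of_ne hc, Function.update_of_ne hc]
      exact hs.Y_card c
  · intro c
    rcases eq_or_ne c j with rfl | hc
    · rw [Function.update_self, Function.update_self, hlog]
      have := hs.log_q c
      push_cast
      linarith
    · rw [Function.update_of_ne hc, Function.update_of_ne hc]
      exact hs.log_q c
  · have h1 := hs.log_X
    cases j
    · simp only [Function.update_self, Function.update_of_ne (show true ≠ false by simp), hlog]
      linarith
    · simp only [Function.update_self, Function.update_of_ne (show false ≠ true by simp), hlog]
      linarith

theorem log_card_sub_le {r : ℝ} {X X' : Finset V} (hX : X.Nonempty)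
    (h : Real.exp (-r) * X.card ≤ X'.card) : Real.log X.card - r ≤ Real.log X'.card := by
  have hX0 : (0 : ℝ) < X.card := by exact_mod_cast hX.card_pos
  have := Real.log_le_log (by positivity) h
  rw [Real.log_mul (Real.exp_pos _).ne' hX0.ne', Real.log_exp] at this
  linarith

/-- As long as no spine is full, the book algorithm continues. -/
theorem BookState.exists_next (hH : IsColouring H)
    (hs : BookState H S t p δ L A X Y T q e) (hP : BookParams t p δ L A)
    (hS : 2 * t * stepLoss t L A - 2 * A * Real.log δ ≤ Real.log S.card)
    (hT : ∀ c, (T c).card < t) :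
    ∃ X' Y' T' q' e', BookState H S t p δ L A X' Y' T' q' e' ∧
      (T' true).card + (T' false).card + e' true + e' false
        = (T true).card + (T false).card + e true + e false + 1 := by
  classical
  have ht : (2 : ℝ) ≤ t := by exact_mod_cast hP.two_le
  have hκ : 15 * √(L + 2) + Real.log 4 ≤ stepLoss t L A := by
    have := hP.A_nonneg
    have : 0 ≤ 2 * A / t := by positivity
    unfold stepLoss
    linarith
  have hlog4 : 0 < Real.log 4 := Real.log_pos (by norm_num)
  have hκ0 : 0 ≤ stepLoss t L A := by
    have := Real.sqrt_nonneg (L + 2)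
    linarith
  -- Both spines lack a vertex, so the budget in `hS` still contains two unspent `stepLoss`.
  have hXlog : 15 * √(L + 2) + Real.log 4 ≤ Real.log X.card := by
    have h1 := hs.log_X
    have h2 : ∀ c, ((T c).card : ℝ) ≤ t - 1 := fun c => by
      have : ((T c).card : ℝ) + 1 ≤ t := by exact_mod_cast hT c
      linarith
    have h3 : ∀ c, A * Real.log (q c) ≤ 0 := fun c =>
      mul_nonpos_of_nonneg_of_nonpos hP.A_nonneg
        (Real.log_nonpos (hs.q_pos c).le (hs.q_le_one hP c))
    have h4 : stepLoss t L A * (((T true).card : ℝ) + (T false).card)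
        ≤ stepLoss t L A * (2 * t - 2) :=
      mul_le_mul_of_nonneg_left (by linarith [h2 true, h2 false]) hκ0
    linarith [h3 true, h3 false]
  obtain ⟨x, hx, X', hX', Y', hY', a, l, hl, hcard, hda, hdc⟩ :=
    exists_pivot H hs.X_pos (hs.Y_pos hP) (p := fun c => p + q c) (α := fun c => q c / t)
      (fun c => add_pos hP.p_pos (hs.q_pos c)) (fun c => div_pos (hs.q_pos c) (by linarith)) hs.deg
  have hX0 : (0 : ℝ) < X.card := by exact_mod_cast hs.X_pos.card_pos
  have hne : X'.Nonempty := by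
    have h1 : (0 : ℝ) < X'.card := lt_of_lt_of_le (by positivity) hcard
    exact Finset.card_pos.1 (by exact_mod_cast h1)
  rcases le_or_gt L l with hLl | hLl
  · refine ⟨_, _, _, _, _, hs.increment_step hP hX' hne hLl
      ((hY' a).1.trans (nbhd_subset _ _ _)) (hY' a).2 hda (log_card_sub_le hs.X_pos hcard), ?_⟩
    cases a <;> simp <;> ring
  · have hX'log : Real.log X.card - 15 * √(L + 2) ≤ Real.log X'.card := by
      refine le_trans ?_ (log_card_sub_le hs.X_pos hcard)
      have : √(l + 2) ≤ √(L + 2) := Real.sqrt_le_sqrt (by linarith)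
      linarith
    have hX'pos : (0 : ℝ) < X'.card := by exact_mod_cast hne.card_pos
    have hX'4 : (4 : ℝ) ≤ X'.card := by
      rw [← Real.log_le_log_iff (by norm_num) hX'pos]
      linarith
    have hsum := card_le_sum_nbhd hH x X'
    -- The pivot joins the spine of a colour popular in `X'`, which need not be the colour `a` of
    -- the level. As `|X'| ≥ 4`, the pivot itself does not spoil the bound of a quarter.
    obtain ⟨j, hj⟩ : ∃ j, (X'.card : ℝ) / 4 ≤ (nbhd (H j) x X').card := by
      by_contra! hcon
      linarith [hcon true, hcon false]
    have hjpos : (0 : ℝ) < (nbhd (H j) x X').card := by linarith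
    refine ⟨_, _, _, _, _, hs.colour_step hP (hT j) hx ((nbhd_subset (H j) x X').trans hX')
      (Finset.card_pos.1 (by exact_mod_cast hjpos)) (fun y hy => (mem_nbhd.1 hy).2) (hY' j).1
      (hY' j).2 (fun y hy => hdc j y (nbhd_subset _ _ _ hy)) ?_, ?_⟩
    · have h1 := Real.log_le_log (by linarith) hj
      rw [Real.log_div hX'pos.ne' (by norm_num)] at h1
      linarith
    · have hxT : x ∉ T j := fun h => (H j).loopless.irrefl x (hs.T_X j x h x hx)
      cases j <;> simp [Finset.card_insert_of_notMem hxT] <;> ring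

/-- The book theorem. -/
theorem exists_book (hH : IsColouring H) (hP : BookParams t p δ L A) (hne : S.Nonempty)
    (hS : 2 * t * stepLoss t L A - 2 * A * Real.log δ ≤ Real.log S.card)
    (hdeg : ∀ c, ∀ x ∈ S, (p + δ) * S.card ≤ ((nbhd (H c) x S).card : ℝ)) :
    ∃ c, ∃ T ⊆ S, ∃ Y ⊆ S, ∃ e : ℕ, T.card = t ∧ (H c).IsClique (T : Set V) ∧
      (∀ x ∈ T, ∀ y ∈ Y, (H c).Adj x y) ∧ p ^ (t + e) * S.card ≤ (Y.card : ℝ) ∧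
      (e : ℝ) * Real.log (1 + L / t) ≤ 2 - Real.log δ := by
  by_contra! hcon
  have ht : (2 : ℝ) ≤ t := by exact_mod_cast hP.two_le
  have hfull : ∀ X Y T q e, BookState H S t p δ L A X Y T q e → ∀ c, (T c).card < t := by
    intro X Y T q e hs c
    refine lt_of_le_of_ne (hs.T_card c) fun h => ?_
    have h1 := hcon c (T c) (hs.T_sub c) (Y c) (hs.Y_sub c) (e c) h (hs.T_clique c) (hs.T_Y c)
      (by rw [← h]; exact hs.Y_card c)
    linarith [hs.increments_le hP c]
  have hrun : ∀ s : ℕ, ∃ X Y T q e, BookState H S t p δ L A X Y T q e ∧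
      (T true).card + (T false).card + e true + e false = s := by
    intro s
    induction s with
    | zero =>
      refine ⟨S, fun _ => S, fun _ => ∅, fun _ => δ, fun _ => 0, ?_, by simp⟩
      constructor
      · exact subset_rfl
      · exact hne
      · exact fun _ => subset_rfl
      · simp
      · simp
      · simp
      · simp
      · simp
      · exact fun _ => hP.δ_pos
      · exact hdeg
      · simp
      · simp
      · simp only [Finset.card_empty, Nat.cast_zero]
        linarith
    | succ s ih =>
      obtain ⟨X, Y, T, q, e, hs, he⟩ := ih
      obtain ⟨X', Y', T', q', e', hs', he'⟩ := hs.exists_next hH hP hS (hfull _ _ _ _ _ hs)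
      exact ⟨X', Y', T', q', e', hs', by omega⟩
  have hlog : 0 < Real.log (1 + L / t) := Real.log_pos (by
    have := hP.L_nonneg
    have : 0 < L / t := by positivity
    linarith)
  -- Every step raises the total of spine sizes and increments by one, but this total is bounded; so
  -- some spine must fill up.
  obtain ⟨X, Y, T, q, e, hs, he⟩ := hrun
    (2 * t + 2 * ⌈(2 - Real.log δ) / Real.log (1 + L / t)⌉₊ + 1)
  have hb : ∀ c, e c ≤ ⌈(2 - Real.log δ) / Real.log (1 + L / t)⌉₊ := fun c => by
    have h1 := hs.increments_le hP c
    rw [← le_div_iff₀ hlog] at h1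
    exact_mod_cast h1.trans (Nat.le_ceil _)
  have := hb true
  have := hb false
  have := hs.T_card true
  have := hs.T_card false
  omega

end

/-! ### From books to an exponential improvement on Erdős–Szekeres. -/

section

variable {V : Type*} {H : Bool → SimpleGraph V}

theorem card_le_exp (hH : IsColouring H) {a b : ℕ} {S : Finset V}
    (ha : CliqueBound (H true) S a) (hb : CliqueBound (H false) S b) (h : ℝ) :
    (S.card : ℝ) ≤ 2 ^ (a + b + 2) * Real.exp ((a + b + 2) * h ^ 2 / 2 - h * (b - a)) := by
  have h1 : (S.card : ℝ) ≤ ((a + b + 2).choose (a + 1) : ℝ) := by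
    exact_mod_cast (card_lt_choose hH a b S ha hb).le
  refine h1.trans ((choose_le_exp _ _ (by omega) h).trans (le_of_eq ?_))
  push_cast
  congr 3
  ring

theorem log_card_le (hH : IsColouring H) {a b : ℕ} {S : Finset V} (hS : S.Nonempty)
    (ha : CliqueBound (H true) S a) (hb : CliqueBound (H false) S b) (h : ℝ) :
    Real.log S.card
      ≤ (a + b + 2) * Real.log 2 + ((a + b + 2) * h ^ 2 / 2 - h * (b - a)) := by
  have h0 : (0 : ℝ) < S.card := by exact_mod_cast hS.card_pos
  have h1 := Real.log_le_log h0 (card_le_exp hH ha hb h)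
  rw [Real.log_mul (by positivity) (Real.exp_pos _).ne', Real.log_exp, Real.log_pow] at h1
  push_cast at h1
  exact h1

/-- Passing to neighbourhoods of atypical vertices, one finds either a set in which all degrees are
balanced, or a set larger than expected. -/
theorem exists_balanced (hH : IsColouring H) {k J : ℕ} (hJ : J ≤ k) {S : Finset V} {ε : ℝ}
    (hε : 0 < ε) (hk : ∀ c, CliqueBound (H c) S k) (hbig : 1 ≤ ε * ((1 / 2) ^ J * S.card)) :
    ∀ j ≤ J, ∃ S' ⊆ S, ∃ d : Bool → ℕ, d true + d false ≤ j ∧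
      (∀ c, CliqueBound (H c) S' (k - d c)) ∧
      (1 / 2 + ε) ^ (d true + d false) * S.card ≤ (S'.card : ℝ) ∧
      (d true + d false = j ∨
        ∀ c, ∀ x ∈ S', (1 / 2 - 2 * ε) * S'.card ≤ ((nbhd (H c) x S').card : ℝ)) := by
  intro j
  induction j with
  | zero => exact fun _ => ⟨S, subset_rfl, fun _ => 0, by simp, by simpa using hk, by simp, by simp⟩
  | succ j ih =>
    intro hj
    obtain ⟨S', hS', d, hd, hc, hcard, hbal⟩ := ih (by omega)
    by_cases hb : ∀ c, ∀ x ∈ S', (1 / 2 - 2 * ε) * S'.card ≤ ((nbhd (H c) x S').card : ℝ)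
    · exact ⟨S', hS', d, by omega, hc, hcard, Or.inr hb⟩
    have hdj : d true + d false = j := hbal.resolve_right hb
    push Not at hb
    obtain ⟨c, x, hx, hlt⟩ := hb
    have hεS : 1 ≤ ε * S'.card := by
      refine hbig.trans (mul_le_mul_of_nonneg_left ?_ hε.le)
      refine le_trans ?_ hcard
      refine mul_le_mul_of_nonneg_right ?_ (Nat.cast_nonneg _)
      calc (1 / 2 : ℝ) ^ J ≤ (1 / 2) ^ (d true + d false) :=
            pow_le_pow_of_le_one (by norm_num) (by norm_num) (by omega)
        _ ≤ (1 / 2 + ε) ^ (d true + d false) := by gcongr; linarith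
    have hsum := card_le_sum_nbhd hH x S'
    -- A deficit of `2 ε` in colour `c` is a surplus of `2 ε` in the other, up to the vertex `x`
    -- itself; `ε |S'| ≥ 1` absorbs that vertex.
    have hlarge : (1 / 2 + ε) * S'.card ≤ ((nbhd (H (!c)) x S').card : ℝ) := by
      cases c
      · simp only [Bool.not_false]; linarith
      · simp only [Bool.not_true]; linarith
    have hdc : d (!c) ≤ j := by cases c <;> simp <;> omega
    have hadd : (Function.update d (!c) (d (!c) + 1)) true
        + (Function.update d (!c) (d (!c) + 1)) false = j + 1 := by
      cases c <;> simp <;> omega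
    refine ⟨nbhd (H (!c)) x S', (nbhd_subset _ _ _).trans hS',
      Function.update d (!c) (d (!c) + 1), hadd.le, fun c' => ?_, ?_, Or.inl hadd⟩
    · rcases eq_or_ne c' (!c) with rfl | hcc
      · rw [Function.update_self]
        refine CliqueBound.nbhd ?_ hx
        have := hc (!c)
        rwa [show k - d (!c) = k - (d (!c) + 1) + 1 by omega] at this
      · rw [Function.update_of_ne hcc]
        exact (hc c').mono (nbhd_subset _ _ _)
    · rw [hadd, pow_succ]
      rw [hdj] at hcard
      calc (1 / 2 + ε) ^ j * (1 / 2 + ε) * (S.card : ℝ)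
          = (1 / 2 + ε) * ((1 / 2 + ε) ^ j * S.card) := by ring
        _ ≤ (1 / 2 + ε) * S'.card := by gcongr
        _ ≤ _ := hlarge

theorem half_le_log_one_add {z : ℝ} (hz : 0 ≤ z) (hz1 : z ≤ 1) : z / 2 ≤ Real.log (1 + z) := by
  refine le_trans ?_ (Real.le_log_one_add_of_nonneg hz)
  rw [div_le_div_iff₀ (by norm_num) (by linarith)]
  nlinarith

/-- The price function of the book algorithm, with threshold `w ^ 2` and slack `1 / w ^ 2`. -/
noncomputable def price (w : ℝ) : ℝ := 30 * √(w ^ 2 + 2) / w ^ 2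

theorem price_bounds {w : ℝ} (hw : 2 ≤ w) : 30 / w ≤ price w ∧ price w ≤ 60 / w := by
  have h1 : w ≤ √(w ^ 2 + 2) := Real.le_sqrt_of_sq_le (by linarith)
  have h2 : √(w ^ 2 + 2) ≤ w + 1 := Real.sqrt_le_iff.2 ⟨by linarith, by nlinarith⟩
  unfold price
  constructor
  · rw [div_le_div_iff₀ (by linarith) (by positivity)]
    nlinarith
  · rw [div_le_div_iff₀ (by positivity) (by linarith)]
    nlinarith

/-- Here `p + δ = 1/2 - 2 / w ^ 2`, the density left by `exists_balanced`. For `l ≤ t`, `log (1 + l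
/ t) ≥ l / (2 t)` and the price is tight at `l = w ^ 2`. For `l > t` the logarithm exceeds `1/2`,
and `t ≥ 9 w ^ 4` gives `√(l + 2) ≤ t / w`. -/
theorem bookParams {w : ℝ} (hw : 1000 ≤ w) {t : ℕ} (ht : 9 * w ^ 4 ≤ t) :
    BookParams t (1 / 2 - 3 * (1 / w ^ 2)) (1 / w ^ 2) (w ^ 2) (price w * t) := by
  obtain ⟨hc1, hc2⟩ := price_bounds (show 2 ≤ w by linarith)
  have hw2 : 1000000 ≤ w ^ 2 := by nlinarith
  have hw4 : w ^ 2 ≤ w ^ 4 := by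
    have : w ^ 4 = w ^ 2 * w ^ 2 := by ring
    nlinarith
  have ht0 : (0 : ℝ) < t := by linarith
  have hp0 : 0 ≤ price w := le_trans (by positivity) hc1
  refine ⟨by exact_mod_cast (show (2 : ℝ) ≤ t by linarith), ?_, by positivity, by positivity,
    by positivity, fun l hl hl2 => ?_⟩
  · have : 1 / w ^ 2 ≤ 1 / 1000000 := one_div_le_one_div_of_le (by norm_num) hw2
    linarith
  have hl0 : 0 < l := by linarith
  rcases le_or_gt l t with hlt | hlt
  · have h1 : l / t / 2 ≤ Real.log (1 + l / t) :=
      half_le_log_one_add (by positivity) (by rw [div_le_one ht0]; exact hlt)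
    have h2 : 15 * √(l + 2) ≤ price w * t * (l / t / 2) := by
      have e : price w * t * (l / t / 2) = 15 * (√(w ^ 2 + 2) * (l / w ^ 2)) := by
        unfold price
        field_simp
        ring
      rw [e]
      refine mul_le_mul_of_nonneg_left ?_ (by norm_num)
      have h3 : l / w ^ 2 = √((l / w ^ 2) ^ 2) := (Real.sqrt_sq (by positivity)).symm
      rw [h3, ← Real.sqrt_mul (by positivity)]
      apply Real.sqrt_le_sqrt
      rw [div_pow, ← mul_div_assoc, le_div_iff₀ (by positivity)]
      set L := w ^ 2
      nlinarith [mul_nonneg (mul_nonneg hl0.le (show 0 ≤ L by positivity)) (sub_nonneg.2 hl)]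
    refine h2.trans (mul_le_mul_of_nonneg_left h1 (by positivity))
  · have h1 : 1 / 2 ≤ Real.log (1 + l / t) := by
      have h2 : (2 : ℝ) ≤ 1 + l / t := by
        have : 1 ≤ l / t := by rw [le_div_iff₀ ht0]; linarith
        linarith
      have h3 := Real.log_le_log (by norm_num) h2
      linarith [Real.log_two_gt_d9]
    have h2 : 15 * √(l + 2) ≤ price w * t * (1 / 2) := by
      have h3 : √(l + 2) ≤ t / w := by
        rw [Real.sqrt_le_iff]
        refine ⟨by positivity, ?_⟩
        have h4 : l ≤ 8 * t * w ^ 2 := by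
          rwa [div_div_eq_mul_div, div_one] at hl2
        rw [div_pow, le_div_iff₀ (by positivity)]
        have h5 : (l + 2) * w ^ 2 ≤ 9 * w ^ 4 * t := by
          have e : 9 * w ^ 4 * (t : ℝ) = 8 * t * w ^ 2 * w ^ 2 + w ^ 2 * t * w ^ 2 := by ring
          rw [e, ← add_mul]
          refine mul_le_mul_of_nonneg_right ?_ (by positivity)
          nlinarith
        nlinarith
      calc 15 * √(l + 2) ≤ 15 * (t / w) := by gcongr
        _ = 30 / w * t * (1 / 2) := by ring
        _ ≤ _ := by gcongr
    exact h2.trans (mul_le_mul_of_nonneg_left h1 (by positivity))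

/-- The reservoir needed by `exists_book`: a colour step costs about `15 w`, and the term in `log δ`
is only `O(t)` because `price w = O(1 / w)`. -/
theorem book_loss_le {w : ℝ} (hw : 1000 ≤ w) {t : ℕ} (ht : 0 < t) :
    2 * t * stepLoss t (w ^ 2) (price w * t) - 2 * (price w * t) * Real.log (1 / w ^ 2)
      ≤ 40 * w * t := by
  obtain ⟨hc1, hc2⟩ := price_bounds (show 2 ≤ w by linarith)
  have ht0 : (0 : ℝ) < t := by exact_mod_cast ht
  have h2 : √(w ^ 2 + 2) ≤ w + 1 := Real.sqrt_le_iff.2 ⟨by linarith, by nlinarith⟩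
  have h3 : Real.log 4 ≤ 3 := by
    have := Real.log_le_sub_one_of_pos (show (0 : ℝ) < 4 by norm_num)
    linarith
  have h4 : price w * w ≤ 60 := by rwa [le_div_iff₀ (by linarith)] at hc2
  have hp0 : 0 ≤ price w := le_trans (by positivity) hc1
  have h5 : price w ≤ 1 := by nlinarith
  have h6 : stepLoss t (w ^ 2) (price w * t) = 15 * √(w ^ 2 + 2) + Real.log 4 + 2 * price w := by
    unfold stepLoss
    field_simp
  have h7 : Real.log w ≤ w := by
    have := Real.log_le_sub_one_of_pos (show 0 < w by linarith)
    linarith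
  have h8 : price w * Real.log w ≤ 60 := (mul_le_mul_of_nonneg_left h7 hp0).trans h4
  rw [h6, one_div, Real.log_inv, Real.log_pow]
  push_cast
  have h9 : 2 * (15 * √(w ^ 2 + 2) + Real.log 4 + 2 * price w) + 4 * (price w * Real.log w)
      ≤ 40 * w := by linarith
  nlinarith

/-- A book in a set with clique bounds `k - d c` has few pages. -/
theorem log_card_pages_le (hH : IsColouring H) {k t : ℕ} (hk : 0 < k) {d : Bool → ℕ}
    (hd : (d true : ℝ) + d false ≤ t / 2) (hdk : ∀ c, d c + t ≤ k) {S T Y : Finset V}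
    (hS : ∀ c, CliqueBound (H c) S (k - d c)) {c : Bool} (hT : T ⊆ S) (hY : Y ⊆ S)
    (hTt : T.card = t) (hTc : (H c).IsClique (T : Set V))
    (hTY : ∀ x ∈ T, ∀ y ∈ Y, (H c).Adj x y) (hYne : Y.Nonempty) (hk2 : 2 ≤ k) :
    Real.log Y.card
      ≤ (2 * k - ((d true : ℝ) + d false) - t + 2) * Real.log 2 - t ^ 2 / (32 * k) := by
  have hk0 : (0 : ℝ) < k := by exact_mod_cast hk
  have hk2' : (2 : ℝ) ≤ k := by exact_mod_cast hk2
  have ht0 : (0 : ℝ) ≤ t := Nat.cast_nonneg _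
  have hd0 : ∀ c, (0 : ℝ) ≤ d c := fun c => Nat.cast_nonneg _
  have hdkN : ∀ c, d c ≤ k := fun c => by have := hdk c; omega
  -- The tilt `t / (8 k)` minimises `4 k h ^ 2 / 2 - h t / 2`. The gap `x` between the clique bounds
  -- is at least `t - (d true + d false) ≥ t / 2`.
  have hb : ∀ x N h : ℝ, t / 2 ≤ x → N ≤ 4 * k → h = t / (8 * k) →
      N * h ^ 2 / 2 - h * x ≤ -(t ^ 2 / (32 * k)) := by
    intro x N h hx hN hh
    have h0 : 0 ≤ h := by rw [hh]; positivity
    have h1 : N * h ^ 2 / 2 ≤ 4 * k * h ^ 2 / 2 := by gcongr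
    have h2 : h * (t / 2) ≤ h * x := by gcongr
    have h3 : 4 * k * h ^ 2 / 2 - h * (t / 2) = -(t ^ 2 / (32 * k)) := by
      rw [hh]; field_simp; ring
    linarith
  have hbook : CliqueBound (H c) Y (k - d c - t) := by
    have h1 := hS c
    rw [show k - d c = k - d c - t + t by have := hdk c; omega] at h1
    exact h1.of_join hT hTc hTt.ge hY hTY
  have hother : ∀ c', CliqueBound (H c') Y (k - d c') := fun c' => (hS c').mono hY
  have hft : t ≤ k - d false := by have := hdk false; omega
  have htt : t ≤ k - d true := by have := hdk true; omega
  cases c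
  · have h1 := log_card_le hH hYne (hother true) hbook (-(t / (8 * k)))
    rw [Nat.cast_sub hft, Nat.cast_sub (hdkN true), Nat.cast_sub (hdkN false)] at h1
    have h2 := hb ((k : ℝ) - d true - (k - d false - t))
      ((k : ℝ) - d true + (k - d false - t) + 2) _
      (by linarith [hd0 true, hd0 false]) (by linarith [hd0 true, hd0 false]) rfl
    have e1 : ((k : ℝ) - d true + (k - d false - t) + 2) * (-(t / (8 * k))) ^ 2 / 2
        - -(t / (8 * k)) * ((k - d false - t) - (k - d true))
        = ((k : ℝ) - d true + (k - d false - t) + 2) * (t / (8 * k)) ^ 2 / 2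
        - (t / (8 * k)) * (k - d true - (k - d false - t)) := by ring
    rw [e1] at h1
    have e2 : ((k : ℝ) - d true + (k - d false - t) + 2) * Real.log 2
      = (2 * k - ((d true : ℝ) + d false) - t + 2) * Real.log 2 := by ring
    linarith
  · have h1 := log_card_le hH hYne hbook (hother false) (t / (8 * k))
    rw [Nat.cast_sub htt, Nat.cast_sub (hdkN true), Nat.cast_sub (hdkN false)] at h1
    have h2 := hb ((k : ℝ) - d false - (k - d true - t))
      ((k : ℝ) - d true - t + (k - d false) + 2) _
      (by linarith [hd0 true, hd0 false]) (by linarith [hd0 true, hd0 false]) rfl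
    have e2 : ((k : ℝ) - d true - t + (k - d false) + 2) * Real.log 2
      = (2 * k - ((d true : ℝ) + d false) - t + 2) * Real.log 2 := by ring
    linarith

/-- Sets with balanced degrees are exponentially smaller than the Erdős–Szekeres bound. -/
theorem log_card_le_of_balanced (hH : IsColouring H) {w : ℝ} (hw : 1000 ≤ w)
    (hw2 : 10240 * (28 + 4 * Real.log w) ≤ w) {k t : ℕ} (ht3 : 9 * w ^ 4 ≤ t)
    (htk : (t : ℝ) * (80 * w) ≤ k) (hkt : (k : ℝ) ≤ t * (160 * w)) {S : Finset V}
    (hne : S.Nonempty) {d : Bool → ℕ} (hd : (d true : ℝ) + d false ≤ t / 2)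
    (hS : ∀ c, CliqueBound (H c) S (k - d c))
    (hbal : ∀ c, ∀ x ∈ S, (1 / 2 - 2 * (1 / w ^ 2)) * S.card ≤ ((nbhd (H c) x S).card : ℝ))
    (hlarge : 40 * w * t ≤ Real.log S.card) :
    Real.log S.card
      ≤ (2 * k - ((d true : ℝ) + d false) + 2) * Real.log 2 - t / (10240 * w) := by
  have hw0 : 0 < w := by linarith
  have hw4 : 1 ≤ w ^ 4 := one_le_pow₀ (by linarith)
  have ht0 : (0 : ℝ) < t := by linarith
  have htN : 0 < t := by exact_mod_cast ht0
  have htk' : (t : ℝ) * 80000 ≤ k := le_trans (by gcongr; linarith) htk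
  have hk0 : (0 : ℝ) < k := by linarith
  have hdk : ∀ c, d c + t ≤ k := by
    intro c
    have h1 : (0 : ℝ) ≤ d true := Nat.cast_nonneg _
    have h2 : (0 : ℝ) ≤ d false := Nat.cast_nonneg _
    have h3 : (d c : ℝ) + t ≤ k := by cases c <;> linarith
    exact_mod_cast h3
  have hSpos : (0 : ℝ) < S.card := by exact_mod_cast hne.card_pos
  have hP := bookParams hw ht3
  obtain ⟨c, T, hT, Y, hY, e, hTt, hTc, hTY, hYc, he⟩ := exists_book hH hP hne
    ((book_loss_le hw htN).trans hlarge) (by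
      intro c x hx
      refine le_trans (le_of_eq ?_) (hbal c x hx)
      ring)
  set p : ℝ := 1 / 2 - 3 * (1 / w ^ 2) with hp
  have hp0 : 0 < p := hP.p_pos
  have hYpos : (0 : ℝ) < Y.card := lt_of_lt_of_le (by positivity) hYc
  have hYne : Y.Nonempty := Finset.card_pos.1 (by exact_mod_cast hYpos)
  have hYlog := log_card_pages_le hH (by exact_mod_cast hk0) hd hdk hS hT hY hTt hTc hTY hYne
    (by exact_mod_cast (show (2 : ℝ) ≤ k by linarith))
  have hlogY : (t + e) * Real.log p + Real.log S.card ≤ Real.log Y.card := by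
    have := Real.log_le_log (by positivity) hYc
    rw [Real.log_mul (by positivity) hSpos.ne', Real.log_pow] at this
    push_cast at this
    exact this
  clear hbal hlarge hT hY hTt hTc hTY hYne hYc hYpos hdk hP hS
  have hlogw : 0 ≤ Real.log w := Real.log_nonneg (by linarith)
  -- With slack `w ^ (-2)` and threshold `w ^ 2`, the number of increments is `O(t log w / w ^ 2)`,
  -- of smaller order than the gain `t / w`.
  have hewt : (e : ℝ) ≤ 4 * t * (1 + Real.log w) * (1 / w ^ 2) := by
    have h1 : w ^ 2 / t / 2 ≤ Real.log (1 + w ^ 2 / t) :=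
      half_le_log_one_add (by positivity) (by
        rw [div_le_one ht0]
        have h2 : w ^ 4 = w ^ 2 * w ^ 2 := by ring
        have h3 : 1 ≤ w ^ 2 := one_le_pow₀ (by linarith)
        have h4 : w ^ 2 ≤ w ^ 2 * w ^ 2 := le_mul_of_one_le_left (by linarith) h3
        linarith)
    have h2 := mul_le_mul_of_nonneg_left h1 (Nat.cast_nonneg (α := ℝ) e)
    have h3 : (e : ℝ) * (w ^ 2 / t / 2) ≤ 2 + 2 * Real.log w := by
      rw [one_div, Real.log_inv, Real.log_pow] at he
      push_cast at he
      linarith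
    have h4 : (e : ℝ) * (w ^ 2 / t / 2) = e * w ^ 2 / (2 * t) := by
      field_simp
    rw [h4, div_le_iff₀ (by positivity)] at h3
    rw [mul_one_div, le_div_iff₀ (by positivity)]
    linarith
  set ε : ℝ := 1 / w ^ 2 with hε
  have hε0 : 0 < ε := by positivity
  have hε1 : ε ≤ 1 / 1000000 := one_div_le_one_div_of_le (by norm_num) (by nlinarith)
  have hlogp : -Real.log 2 - 12 * ε ≤ Real.log p := by
    have h1 : p = (1 - 6 * ε) / 2 := by rw [hp]; ring
    rw [h1, Real.log_div (by linarith) (by norm_num)]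
    have h2 := Real.one_sub_inv_le_log_of_pos (show 0 < 1 - 6 * ε by linarith)
    have h3 : (1 - 6 * ε)⁻¹ ≤ 1 + 12 * ε := by
      rw [inv_le_comm₀ (by linarith) (by linarith), ← one_div, div_le_iff₀ (by linarith)]
      nlinarith
    linarith
  have het : (e : ℝ) ≤ t := by
    refine hewt.trans ?_
    have h1 : 4 * (1 + Real.log w) * ε ≤ 1 := by
      rw [hε, mul_one_div, div_le_one (by positivity)]
      have : w ≤ w ^ 2 := by nlinarith
      linarith
    calc 4 * t * (1 + Real.log w) * ε = t * (4 * (1 + Real.log w) * ε) := by ring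
      _ ≤ t * 1 := by gcongr
      _ = t := mul_one _
  have hgain : t / (5120 * w) ≤ (t : ℝ) ^ 2 / (32 * k) := by
    rw [div_le_div_iff₀ (by positivity) (by positivity)]
    calc (t : ℝ) * (32 * k) ≤ t * (32 * (t * (160 * w))) := by gcongr
      _ = (t : ℝ) ^ 2 * (5120 * w) := by ring
  have hln2 : Real.log 2 ≤ 1 := by linarith [Real.log_two_lt_d9]
  have h1 : ((t : ℝ) + e) * (-Real.log 2 - 12 * ε) ≤ (t + e) * Real.log p := by gcongr
  have h2 : (e : ℝ) * Real.log 2 ≤ e * 1 := by gcongr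
  have h3 : ((t : ℝ) + e) * (12 * ε) ≤ (2 * t) * (12 * ε) := by gcongr; linarith
  -- `hw2` is tailored to this: all losses together use at most half of the gain `t / (5120 w)`.
  have h4 : (28 + 4 * Real.log w) * t * ε ≤ t / (10240 * w) := by
    rw [hε, mul_one_div, div_le_div_iff₀ (by positivity) (by positivity)]
    have : (28 + 4 * Real.log w) * t * (10240 * w)
        = (10240 * (28 + 4 * Real.log w)) * (t * w) := by ring
    rw [this, show (t : ℝ) * w ^ 2 = w * (t * w) by ring]
    gcongr
  have h5 : (t : ℝ) / (5120 * w) = 2 * (t / (10240 * w)) := by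
    field_simp
    norm_num
  have h6 : 4 * t * (1 + Real.log w) * ε + (2 * t) * (12 * ε) = (28 + 4 * Real.log w) * t * ε := by
    ring
  have e1 : (2 * k - ((d true : ℝ) + d false) - t + 2) * Real.log 2
    = (2 * k - ((d true : ℝ) + d false) + 2) * Real.log 2 - t * Real.log 2 := by ring
  have e2 : ((t : ℝ) + e) * (-Real.log 2 - 12 * ε)
    = -(t * Real.log 2) - e * Real.log 2 - (t + e) * (12 * ε) := by ring
  linarith

/-- An exponential improvement of the Erdős–Szekeres bound, in logarithmic form. -/
theorem log_card_lt_of_cliqueBound (hH : IsColouring H) {w : ℝ} (hw : 1000 ≤ w)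
    (hw2 : 10240 * (28 + 4 * Real.log w) ≤ w) {k : ℕ} (hk : 3000 * w ^ 5 ≤ k) {S : Finset V}
    (hS : ∀ c, CliqueBound (H c) S k) (hne : S.Nonempty) :
    Real.log S.card < 2 * k * Real.log 2 - k / (1280 * w ^ 3) := by
  by_contra! hcon
  have hw0 : 0 < w := by linarith
  have hk0 : (0 : ℝ) < k := lt_of_lt_of_le (by positivity) hk
  have hln2 := Real.log_two_gt_d9
  have hln2' := Real.log_two_lt_d9
  have hSpos : (0 : ℝ) < S.card := by exact_mod_cast hne.card_pos
  -- With this `t` the loss `40 w t` is at most `k / 2`, which `log |S'|` exceeds.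
  set t : ℕ := ⌊(k : ℝ) / (80 * w)⌋₊ with ht
  have ht1 : (t : ℝ) ≤ k / (80 * w) := Nat.floor_le (by positivity)
  have ht1' : (t : ℝ) * (80 * w) ≤ k := by rwa [le_div_iff₀ (by positivity)] at ht1
  have hkw : 3000 * w ^ 4 ≤ k / w := by
    rw [le_div_iff₀ hw0]
    linarith
  have hw4 : 1 ≤ w ^ 4 := one_le_pow₀ (by linarith)
  have ht2 : (k : ℝ) / (160 * w) ≤ t := by
    have h1 := Nat.lt_floor_add_one ((k : ℝ) / (80 * w))
    have h2 : (k : ℝ) / (80 * w) = k / w / 80 := by rw [mul_comm, div_div]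
    have h3 : (k : ℝ) / (160 * w) = k / w / 160 := by rw [mul_comm, div_div]
    rw [← ht] at h1
    rw [h3]
    rw [h2] at h1
    linarith
  have ht2' : (k : ℝ) ≤ t * (160 * w) := by rwa [div_le_iff₀ (by positivity)] at ht2
  have ht3 : 9 * w ^ 4 ≤ t := by
    have h3 : (k : ℝ) / (160 * w) = k / w / 160 := by rw [mul_comm, div_div]
    rw [h3] at ht2
    linarith
  have ht0 : (0 : ℝ) < t := lt_of_lt_of_le (by positivity) ht3
  have htk : (t : ℝ) ≤ k / 80000 := by
    rw [le_div_iff₀ (by norm_num)]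
    exact le_trans (by gcongr; linarith) ht1'
  set J : ℕ := t / 2 with hJ
  have hJ1 : (J : ℝ) ≤ t / 2 := by
    have : 2 * J ≤ t := by omega
    have : (2 : ℝ) * J ≤ t := by exact_mod_cast this
    linarith
  have hJ2 : (t : ℝ) / 4 ≤ J := by
    have h1 : t ≤ 2 * J + 1 := by omega
    have h2 : (t : ℝ) ≤ 2 * J + 1 := by exact_mod_cast h1
    linarith
  set ε : ℝ := 1 / w ^ 2 with hε
  have hε0 : 0 < ε := by positivity
  have hε1 : ε ≤ 1 / 1000000 := one_div_le_one_div_of_le (by norm_num) (by nlinarith)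
  have hcw : (k : ℝ) / (1280 * w ^ 3) ≤ k / 1000 := by
    apply div_le_div_of_nonneg_left hk0.le (by norm_num)
    have : 1 ≤ w ^ 3 := one_le_pow₀ (by linarith)
    linarith
  have hlogJ : (k : ℝ) ≤ Real.log ((1 / 2) ^ J * S.card) := by
    rw [Real.log_mul (by positivity) hSpos.ne', Real.log_pow, one_div, Real.log_inv]
    have h1 : (J : ℝ) * Real.log 2 ≤ J * 1 := by gcongr; linarith
    have h2 : (k : ℝ) * 0.693 ≤ k * Real.log 2 := by gcongr; linarith
    linarith
  have hexpk : Real.exp k ≤ (1 / 2) ^ J * S.card := by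
    rwa [Real.le_log_iff_exp_le (by positivity)] at hlogJ
  have hbig : 1 ≤ ε * ((1 / 2) ^ J * S.card) := by
    have h1 := Real.add_one_le_exp (k : ℝ)
    have h2 : w ^ 2 ≤ k := by
      refine le_trans ?_ hk
      have : 1 ≤ w ^ 3 := one_le_pow₀ (by linarith)
      have e : 3000 * w ^ 5 = 3000 * w ^ 3 * w ^ 2 := by ring
      rw [e]
      exact le_mul_of_one_le_left (sq_nonneg w) (by linarith)
    rw [hε, one_div, ← div_eq_inv_mul, le_div_iff₀ (by positivity)]
    linarith
  have hJk : J ≤ k := by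
    have : (J : ℝ) ≤ k := by linarith
    exact_mod_cast this
  obtain ⟨S', hS', d, hd, hc, hcard, hbal⟩ := exists_balanced hH hJk hε0 hS hbig J le_rfl
  have hS'pos : (0 : ℝ) < S'.card := lt_of_lt_of_le (by positivity) hcard
  have hS'ne : S'.Nonempty := Finset.card_pos.1 (by exact_mod_cast hS'pos)
  have hlogS' : Real.log S.card + (d true + d false : ℕ) * Real.log (1 / 2 + ε)
      ≤ Real.log S'.card := by
    have := Real.log_le_log (by positivity) hcard
    rw [Real.log_mul (by positivity) hSpos.ne', Real.log_pow] at this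
    linarith
  have hloghalf : Real.log (1 / 2 + ε) = Real.log (1 + 2 * ε) - Real.log 2 := by
    rw [← Real.log_div (by positivity) (by norm_num)]
    congr 1
    ring
  have hlogε : ε ≤ Real.log (1 + 2 * ε) := by
    have := half_le_log_one_add (z := 2 * ε) (by positivity) (by linarith)
    linarith
  have hdJ : ((d true : ℝ)) + d false ≤ J := by exact_mod_cast hd
  have hdk : ∀ c, (d c : ℝ) ≤ J := by
    intro c
    have h1 : (0 : ℝ) ≤ d true := Nat.cast_nonneg _
    have h2 : (0 : ℝ) ≤ d false := Nat.cast_nonneg _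
    cases c <;> linarith
  have hdkN : ∀ c, d c ≤ k := fun c => by
    have : d c ≤ J := by exact_mod_cast hdk c
    omega
  have hconst : 2 * Real.log 2 < k / (1280 * w ^ 3) := by
    rw [lt_div_iff₀ (by positivity)]
    have : w ^ 5 = w ^ 3 * w ^ 2 := by ring
    have : 1 ≤ w ^ 2 := one_le_pow₀ (by linarith)
    have h0 : 0 < w ^ 3 := by positivity
    have h1 : w ^ 3 * 1 ≤ w ^ 3 * w ^ 2 := by gcongr
    have h2 : 2 * Real.log 2 * (1280 * w ^ 3) ≤ 1.4 * (1280 * w ^ 3) := by gcongr; linarith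
    linarith
  rcases hbal with hfull | hbal
  · -- the unbalanced case
    have h1 := log_card_le hH hS'ne (hc true) (hc false) 0
    rw [Nat.cast_sub (hdkN true), Nat.cast_sub (hdkN false)] at h1
    have h2 : ((d true : ℝ)) + d false = J := by exact_mod_cast hfull
    push_cast at hlogS'
    rw [hloghalf, h2] at hlogS'
    have h3 : (J : ℝ) * ε ≤ J * Real.log (1 + 2 * ε) := by gcongr
    -- Each of the `J` moves gained a factor `1 + 2 ε`. Half of the total gain is spent on the
    -- additive `2 * log 2`.
    have h4 : (k : ℝ) / (640 * w ^ 3) ≤ J * ε := by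
      rw [hε, mul_one_div, div_le_div_iff₀ (by positivity) (by positivity)]
      have : (k : ℝ) ≤ J * (640 * w) :=
        calc (k : ℝ) ≤ t * (160 * w) := ht2'
          _ ≤ (4 * J) * (160 * w) := by gcongr; linarith
          _ = J * (640 * w) := by ring
      calc (k : ℝ) * w ^ 2 ≤ J * (640 * w) * w ^ 2 := by gcongr
        _ = J * (640 * w ^ 3) := by ring
    have h5 : (k : ℝ) / (640 * w ^ 3) = 2 * (k / (1280 * w ^ 3)) := by
      field_simp
      norm_num
    have h6 : ((k : ℝ) - d true + (k - d false) + 2) * Real.log 2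
        = 2 * k * Real.log 2 - J * Real.log 2 + 2 * Real.log 2 := by
      rw [← h2]; ring
    rw [h6] at h1
    linarith
  · -- the balanced case
    have hlogS'2 : Real.log S.card - ((d true : ℝ) + d false) * Real.log 2 ≤ Real.log S'.card := by
      push_cast at hlogS'
      rw [hloghalf] at hlogS'
      have : 0 ≤ ((d true : ℝ) + d false) * Real.log (1 + 2 * ε) :=
        mul_nonneg (by positivity) (by linarith)
      linarith
    have hdlog : ((d true : ℝ) + d false) * Real.log 2 ≤ J * Real.log 2 := by gcongr
    have hloss : 40 * w * t ≤ Real.log S'.card := by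
      have h1 : (J : ℝ) * Real.log 2 ≤ J * 1 := by gcongr; linarith
      have h2 : (k : ℝ) * 0.693 ≤ k * Real.log 2 := by gcongr; linarith
      have h3 : 40 * w * t = t * (80 * w) / 2 := by ring
      linarith
    have h1 := log_card_le_of_balanced hH hw hw2 ht3 ht1' ht2' hS'ne (by linarith) hc hbal hloss
    have h2 : (2 * k - ((d true : ℝ) + d false) + 2) * Real.log 2
      = 2 * k * Real.log 2 - ((d true : ℝ) + d false) * Real.log 2 + 2 * Real.log 2 := by ring
    -- Here the gain is of order `k / w ^ 2`; `hw2` forces `w ≥ 2560`, so it exceeds twice the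
    -- claimed saving.
    have h6 : 2 * (k / (1280 * w ^ 3)) ≤ t / (10240 * w) := by
      rw [← mul_div_assoc, div_le_div_iff₀ (by positivity) (by positivity)]
      have h7 : 16 * 160 * w ≤ w ^ 2 := by
        have h8 : 16 * 160 ≤ w := by
          have := Real.log_nonneg (show 1 ≤ w by linarith)
          linarith
        rw [sq]
        gcongr
      calc 2 * (k : ℝ) * (10240 * w) ≤ 2 * (t * (160 * w)) * (10240 * w) := by gcongr
        _ = 1280 * t * w * (16 * 160 * w) := by ring
        _ ≤ 1280 * t * w * w ^ 2 := by gcongr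
        _ = t * (1280 * w ^ 3) := by ring
    linarith

end

/-- The diagonal Ramsey numbers improve exponentially on `4 ^ k`. -/
theorem exists_exponential_improvement : ∃ c : ℝ, 0 < c ∧ ∃ k₀ : ℕ, ∀ k ≥ k₀,
    ∀ {V : Type} {H : Bool → SimpleGraph V} {S : Finset V}, IsColouring H → S.Nonempty →
      (∀ a, CliqueBound (H a) S k) → Real.log S.card < 2 * k * Real.log 2 - c * k := by
  -- A power of two makes the logarithm explicit; any fixed `w ≥ 1000` satisfying this inequality
  -- would serve.
  have hw : 10240 * (28 + 4 * Real.log ((2 : ℝ) ^ 24)) ≤ 2 ^ 24 := by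
    rw [Real.log_pow]
    push_cast
    linarith [Real.log_two_lt_d9]
  refine ⟨1 / (1280 * ((2 : ℝ) ^ 24) ^ 3), by positivity, ⌈3000 * ((2 : ℝ) ^ 24) ^ 5⌉₊,
    fun k hk V H S hH hne hS => ?_⟩
  have h := log_card_lt_of_cliqueBound hH (by norm_num) hw (Nat.ceil_le.1 hk) hS hne
  rwa [one_div_mul_eq_div]

/-! ### The profile function, its Riemann sums and entropy bounds. -/

/-- The derivative of `g`, in natural logarithms. -/
noncomputable def slope (u : ℝ) : ℝ := (2 - u) * Real.log (2 - u) - (1 - u) * Real.log (1 - u)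

/-- The function `g` in natural logarithms. -/
noncomputable def gNat (u : ℝ) : ℝ :=
  1 / 2 * (4 * Real.log 2 - u + (1 - u) * ((1 - u) * Real.log (1 - u))
    - (2 - u) * ((2 - u) * Real.log (2 - u)))

theorem continuous_slope : Continuous slope := by
  unfold slope
  exact (Real.continuous_mul_log.comp (continuous_const.sub continuous_id)).sub
    (Real.continuous_mul_log.comp (continuous_const.sub continuous_id))

/-- Grouping the terms as `x * (x * log x)` makes `u = 1` unexceptional, so the separate case in `g`
disappears. -/
theorem continuous_gNat : Continuous gNat := by
  unfold gNat
  have h1 : Continuous fun u : ℝ => (1 - u) * Real.log (1 - u) :=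
    Real.continuous_mul_log.comp (continuous_const.sub continuous_id)
  have h2 : Continuous fun u : ℝ => (2 - u) * Real.log (2 - u) :=
    Real.continuous_mul_log.comp (continuous_const.sub continuous_id)
  fun_prop

theorem hasDerivAt_sub_mul_log {a u : ℝ} (h : u < a) :
    HasDerivAt (fun u => (a - u) * Real.log (a - u)) (-Real.log (a - u) - 1) u := by
  have h1 := (Real.hasDerivAt_mul_log (sub_pos.2 h).ne').comp u ((hasDerivAt_id u).const_sub a)
  refine h1.congr_deriv ?_
  ring

theorem hasDerivAt_gNat {u : ℝ} (hu : u < 1) : HasDerivAt gNat (slope u) u := by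
  have h1 := hasDerivAt_sub_mul_log hu
  have h2 := hasDerivAt_sub_mul_log (show u < 2 by linarith)
  have e1 := ((hasDerivAt_id u).const_sub 1).mul h1
  have e2 := ((hasDerivAt_id u).const_sub 2).mul h2
  have h3 := (((((hasDerivAt_id u).const_sub (4 * Real.log 2)).add e1).sub e2)).const_mul (1 / 2)
  refine h3.congr_deriv ?_
  simp only [id, slope]
  ring

theorem antitoneOn_slope : AntitoneOn slope (Set.Icc 0 1) := by
  have hd : ∀ u ∈ interior (Set.Icc (0 : ℝ) 1),
      HasDerivAt slope ((-Real.log (2 - u) - 1) - (-Real.log (1 - u) - 1)) u := by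
    intro u hu
    rw [interior_Icc] at hu
    exact (hasDerivAt_sub_mul_log (by linarith [hu.2])).sub (hasDerivAt_sub_mul_log hu.2)
  refine antitoneOn_of_deriv_nonpos (convex_Icc 0 1) continuous_slope.continuousOn
    (fun u hu => (hd u hu).differentiableAt.differentiableWithinAt) fun u hu => ?_
  rw [(hd u hu).deriv]
  rw [interior_Icc] at hu
  have := Real.log_le_log (show 0 < 1 - u by linarith [hu.2]) (show 1 - u ≤ 2 - u by linarith)
  linarith

theorem slope_one : slope 1 = 0 := by norm_num [slope]

theorem slope_nonneg {u : ℝ} (h0 : 0 ≤ u) (h1 : u ≤ 1) : 0 ≤ slope u := by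
  have := antitoneOn_slope ⟨h0, h1⟩ ⟨zero_le_one, le_rfl⟩ h1
  rwa [slope_one] at this

theorem slope_pos {u : ℝ} (h0 : 0 ≤ u) (h1 : u < 1) : 0 < slope u := by
  have h2 : 0 < (2 - u) * Real.log (2 - u) :=
    mul_pos (by linarith) (Real.log_pos (by linarith))
  have h3 : (1 - u) * Real.log (1 - u) ≤ 0 :=
    mul_nonpos_of_nonneg_of_nonpos (by linarith) (Real.log_nonpos (by linarith) (by linarith))
  unfold slope
  linarith

theorem concaveOn_gNat : ConcaveOn ℝ (Set.Icc 0 1) gNat := by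
  have hd : ∀ u ∈ interior (Set.Icc (0 : ℝ) 1), HasDerivAt gNat (slope u) u := fun u hu => by
    rw [interior_Icc] at hu
    exact hasDerivAt_gNat hu.2
  refine AntitoneOn.concaveOn_of_deriv (convex_Icc 0 1) continuous_gNat.continuousOn
    (fun u hu => (hd u hu).differentiableAt.differentiableWithinAt) fun u hu v hv huv => ?_
  rw [(hd u hu).deriv, (hd v hv).deriv]
  exact antitoneOn_slope (interior_subset hu) (interior_subset hv) huv

theorem strictMonoOn_gNat : StrictMonoOn gNat (Set.Icc 0 1) := by
  refine strictMonoOn_of_deriv_pos (convex_Icc 0 1) continuous_gNat.continuousOn fun u hu => ?_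
  rw [interior_Icc] at hu
  rw [(hasDerivAt_gNat hu.2).deriv]
  exact slope_pos hu.1.le hu.2

theorem gNat_zero : gNat 0 = 0 := by
  norm_num [gNat]
  ring

theorem g_eq {c : ℝ} (hc : c ≤ 1) : g c = gNat c / Real.log 2 := by
  have h2 : Real.log 2 ≠ 0 := (Real.log_pos (by norm_num)).ne'
  unfold g gNat
  simp only [Real.logb, Real.log_exp]
  split_ifs with h
  · field_simp
  · obtain rfl : c = 1 := le_antisymm hc (not_lt.1 h)
    norm_num
    field_simp

theorem g₁_eq {c : ℝ} (hc : c ≤ 1 / 2) : g₁ c = 1 / 4 * (gNat (2 * c) / Real.log 2) := by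
  rw [g₁, if_pos hc, g_eq (by linarith)]

theorem g₁_half : g₁ (1 / 2) = 1 / 8 * (4 - Real.logb 2 (Real.exp 1)) := by
  norm_num [g₁, g]
  ring

theorem concaveOn_g₁ : ConcaveOn ℝ (Set.Icc 0 (1 / 2)) g₁ := by
  refine ⟨convex_Icc _ _, fun x hx y hy a b ha hb hab => ?_⟩
  have h2 : 0 < Real.log 2 := Real.log_pos (by norm_num)
  have hxy := convex_Icc (0 : ℝ) (1 / 2) hx hy ha hb hab
  have h := concaveOn_gNat.2
    (show 2 * x ∈ Set.Icc (0 : ℝ) 1 from ⟨by linarith [hx.1], by linarith [hx.2]⟩)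
    (show 2 * y ∈ Set.Icc (0 : ℝ) 1 from ⟨by linarith [hy.1], by linarith [hy.2]⟩) ha hb hab
  rw [g₁_eq hx.2, g₁_eq hy.2, g₁_eq hxy.2]
  simp only [smul_eq_mul] at h ⊢
  rw [show 2 * (a * x + b * y) = a * (2 * x) + b * (2 * y) by ring]
  have h3 := div_le_div_of_nonneg_right h h2.le
  rw [add_div, mul_div_assoc, mul_div_assoc] at h3
  linarith

theorem strictMonoOn_g₁ : StrictMonoOn g₁ (Set.Icc 0 (1 / 2)) := by
  intro x hx y hy hxy
  have h2 : 0 < Real.log 2 := Real.log_pos (by norm_num)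
  rw [g₁_eq hx.2, g₁_eq hy.2]
  have h := strictMonoOn_gNat
    (show 2 * x ∈ Set.Icc (0 : ℝ) 1 from ⟨by linarith [hx.1], by linarith [hx.2]⟩)
    (show 2 * y ∈ Set.Icc (0 : ℝ) 1 from ⟨by linarith [hy.1], by linarith [hy.2]⟩)
    (show 2 * x < 2 * y by linarith)
  have := div_lt_div_of_pos_right h h2
  linarith

/-- Riemann sums of `slope` are bounded by `gNat`. -/
theorem sum_slope_le {m k : ℕ} (hm : 0 < m) (hk : k ≤ m) :
    ∑ i ∈ Finset.range k, slope (i / m) ≤ 2 * Real.log 2 + m * gNat (k / m) := by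
  have hm0 : (0 : ℝ) < m := by exact_mod_cast hm
  -- Since `slope` decreases, its value at the right endpoint of a cell is at most its mean there.
  -- The term `i = 0` has no cell and gives `slope 0 = 2 * log 2`.
  have key : ∀ k : ℕ, k ≤ m →
      ∑ i ∈ Finset.range (k + 1), slope (i / m) ≤ 2 * Real.log 2 + m * gNat (k / m) := by
    intro k
    induction k with
    | zero => simp [gNat_zero, slope]
    | succ k ih =>
      intro hk
      have h1 := ih (by omega)
      rw [Finset.sum_range_succ]
      have hk1 : (k : ℝ) / m < ((k + 1 : ℕ) : ℝ) / m := by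
        gcongr
        exact_mod_cast k.lt_succ_self
      have hk2 : ((k + 1 : ℕ) : ℝ) / m ≤ 1 := by
        rw [div_le_one hm0]; exact_mod_cast hk
      have hk0 : 0 ≤ (k : ℝ) / m := by positivity
      have h2 := Convex.mul_sub_le_image_sub_of_le_deriv
        (convex_Icc ((k : ℝ) / m) (((k + 1 : ℕ) : ℝ) / m)) continuous_gNat.continuousOn
        (C := slope (((k + 1 : ℕ) : ℝ) / m))
        (fun u hu => by
          rw [interior_Icc] at hu
          exact (hasDerivAt_gNat (by linarith [hu.2])).differentiableAt.differentiableWithinAt)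
        (fun u hu => by
          rw [interior_Icc] at hu
          rw [(hasDerivAt_gNat (by linarith [hu.2])).deriv]
          exact antitoneOn_slope ⟨by linarith [hu.1], by linarith [hu.2]⟩
            ⟨by linarith, hk2⟩ hu.2.le)
        _ ⟨le_rfl, hk1.le⟩ _ ⟨hk1.le, le_rfl⟩ hk1.le
      have h3 : ((k + 1 : ℕ) : ℝ) / m - k / m = 1 / m := by
        push_cast; ring
      rw [h3, mul_one_div, div_le_iff₀ hm0] at h2
      linarith
  refine le_trans ?_ (key k hk)
  rw [Finset.sum_range_succ]
  have : 0 ≤ slope ((k : ℝ) / m) := slope_nonneg (by positivity) (by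
    rw [div_le_one hm0]; exact_mod_cast hk)
  linarith

/-- The entropy bound, from a single term of `(j + (N - j)) ^ N`. -/
theorem log_choose_le {N j : ℕ} (hj : 0 < j) (hjN : j < N) :
    Real.log (N.choose j) ≤ N * Real.log N - j * Real.log j
      - ((N : ℝ) - j) * Real.log ((N : ℝ) - j) := by
  have hj0 : (0 : ℝ) < j := by exact_mod_cast hj
  have hN0 : (0 : ℝ) < (N : ℝ) - j := by
    rw [sub_pos]; exact_mod_cast hjN
  have hc : (0 : ℝ) < (N.choose j : ℝ) := by exact_mod_cast Nat.choose_pos hjN.le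
  have h1 : (j : ℝ) ^ j * ((N : ℝ) - j) ^ (N - j) * (N.choose j : ℝ) ≤ (N : ℝ) ^ N := by
    have h2 := add_pow (j : ℝ) ((N : ℝ) - j) N
    rw [add_sub_cancel] at h2
    rw [h2]
    exact Finset.single_le_sum (f := fun i : ℕ =>
      (j : ℝ) ^ i * ((N : ℝ) - j) ^ (N - i) * (N.choose i : ℝ))
      (fun i _ => by positivity) (Finset.mem_range.2 (by omega))
  have h3 := Real.log_le_log (by positivity) h1
  rw [Real.log_mul (by positivity) hc.ne', Real.log_mul (by positivity) (by positivity),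
    Real.log_pow, Real.log_pow, Real.log_pow, Nat.cast_sub hjN.le] at h3
  linarith

/-- After scaling by `m` the contributions of `log m` cancel, since `(2 - u) - (1 - u) - 1 = 0`. -/
theorem choose_le_exp_slope {m i : ℕ} (hi : i < m) :
    ((2 * m - i).choose (m - i) : ℝ) ≤ Real.exp (m * slope (i / m)) := by
  have hm0 : (0 : ℝ) < m := by exact_mod_cast (show 0 < m by omega)
  have hi0 : (i : ℝ) < m := by exact_mod_cast hi
  have hc : (0 : ℝ) < ((2 * m - i).choose (m - i) : ℝ) := by
    exact_mod_cast Nat.choose_pos (by omega)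
  rw [← Real.log_le_iff_le_exp hc]
  refine (log_choose_le (by omega) (by omega)).trans (le_of_eq ?_)
  rw [Nat.cast_sub hi.le, Nat.cast_sub (by omega)]
  push_cast
  have e1 : (2 : ℝ) * m - i - (m - i) = m := by ring
  have e2 : (2 : ℝ) * m - i = m * (2 - i / m) := by field_simp
  have e3 : (m : ℝ) - i = m * (1 - i / m) := by field_simp
  have h1 : 0 < 1 - (i : ℝ) / m := by
    rw [sub_pos, div_lt_one hm0]; exact hi0
  rw [e1, e2, e3, Real.log_mul hm0.ne' (by linarith), Real.log_mul hm0.ne' h1.ne', slope]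
  ring

/-! ### Counting cliques from above. -/

section

variable {n : ℕ}

open Classical in
/-- The cliques on `k` vertices. -/
noncomputable def cliques (G : SimpleGraph (Fin n)) (k : ℕ) : Finset (Finset (Fin n)) :=
  Finset.univ.filter fun s => G.IsClique (s : Set (Fin n)) ∧ s.card = k

theorem mem_cliques {G : SimpleGraph (Fin n)} {k : ℕ} {s : Finset (Fin n)} :
    s ∈ cliques G k ↔ G.IsClique (s : Set (Fin n)) ∧ s.card = k := by
  simp [cliques]

/-- Every larger clique is a `k`-clique plus a common neighbour. The overcounting, by a factor `k +
1`, is negligible at this scale. -/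
theorem card_cliques_succ_le {G : SimpleGraph (Fin n)} {k : ℕ} {B : ℝ}
    (hB : ∀ K ∈ cliques G k, ∀ S : Finset (Fin n), (∀ x ∈ K, ∀ y ∈ S, G.Adj x y) →
      (S.card : ℝ) ≤ B) :
    ((cliques G (k + 1)).card : ℝ) ≤ (cliques G k).card * B := by
  classical
  set N : Finset (Fin n) → Finset (Fin n) := fun K => Finset.univ.filter fun y => ∀ x ∈ K, G.Adj x y
    with hN
  have hsub : cliques G (k + 1)
      ⊆ (cliques G k).biUnion fun K => (N K).image fun x => insert x K := by
    intro s hs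
    obtain ⟨hs1, hs2⟩ := mem_cliques.1 hs
    obtain ⟨x, hx⟩ := Finset.card_pos.1 (show 0 < s.card by omega)
    rw [Finset.mem_biUnion]
    refine ⟨s.erase x, mem_cliques.2 ⟨hs1.subset (by simp), by
      rw [Finset.card_erase_of_mem hx]; omega⟩, ?_⟩
    rw [Finset.mem_image]
    refine ⟨x, ?_, Finset.insert_erase hx⟩
    simp only [hN, Finset.mem_filter, Finset.mem_univ, true_and, Finset.mem_erase]
    exact fun y hy => hs1 hy.2 hx hy.1
  calc ((cliques G (k + 1)).card : ℝ)
      ≤ (((cliques G k).biUnion fun K => (N K).image fun x => insert x K).card : ℝ) := by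
        exact_mod_cast Finset.card_le_card hsub
    _ ≤ ∑ K ∈ cliques G k, (((N K).image fun x => insert x K).card : ℝ) := by
        exact_mod_cast Finset.card_biUnion_le
    _ ≤ ∑ K ∈ cliques G k, B := by
        refine Finset.sum_le_sum fun K hK => ?_
        refine le_trans (by exact_mod_cast Finset.card_image_le) (hB K hK (N K) ?_)
        intro x hx y hy
        simp only [hN, Finset.mem_filter] at hy
        exact hy.2 x hx
    _ = _ := by rw [Finset.sum_const, nsmul_eq_mul]

/-- The Erdős–Szekeres bound for the number of cliques of a given size. -/
theorem card_cliques_le {H : Bool → SimpleGraph (Fin n)} (hH : IsColouring H) {m : ℕ}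
    (hm : ∀ c, CliqueBound (H c) Finset.univ m) {k : ℕ} (hk : k ≤ m + 1) :
    ((cliques (H true) k).card : ℝ)
      ≤ Real.exp (2 * (m + 1) * Real.log 2 + (m + 1) ^ 2 * gNat (k / (m + 1))) := by
  have h1 : ∀ k ≤ m + 1, ((cliques (H true) k).card : ℝ)
      ≤ Real.exp (∑ i ∈ Finset.range k, ((m + 1 : ℕ) : ℝ) * slope (i / (m + 1 : ℕ))) := by
    intro k
    induction k with
    | zero =>
      intro _
      have : cliques (H true) 0 ⊆ {∅} := fun s hs => by
        simpa using (mem_cliques.1 hs).2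
      simpa using (Nat.cast_le (α := ℝ)).2 (Finset.card_le_card this)
    | succ k ih =>
      intro hk
      rw [Finset.sum_range_succ, Real.exp_add]
      have h2 := card_cliques_succ_le (G := H true) (k := k)
        (B := Real.exp (((m + 1 : ℕ) : ℝ) * slope (k / (m + 1 : ℕ)))) (by
          intro K hK S hKS
          obtain ⟨hK1, hK2⟩ := mem_cliques.1 hK
          -- Only the bound in the clique's own colour drops, which gives the binomial coefficient
          -- with parameters `2 (m + 1) - k` and `m + 1 - k`.
          have h3 : CliqueBound (H true) S (m - k) := by
            have h4 := hm true
            rw [show m = m - k + k by omega] at h4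
            exact h4.of_join (Finset.subset_univ K) hK1 hK2.ge (Finset.subset_univ S) hKS
          have h4 := card_lt_choose hH _ _ S h3 ((hm false).mono (Finset.subset_univ S))
          rw [show m - k + m + 2 = 2 * (m + 1) - k by omega,
            show m - k + 1 = m + 1 - k by omega] at h4
          exact le_trans (by exact_mod_cast h4.le) (choose_le_exp_slope (by omega)))
      exact h2.trans (mul_le_mul_of_nonneg_right (ih (by omega)) (Real.exp_pos _).le)
  refine (h1 k hk).trans (Real.exp_le_exp.2 ?_)
  rw [← Finset.mul_sum]
  have h2 := mul_le_mul_of_nonneg_left (sum_slope_le (Nat.succ_pos m) hk)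
    (Nat.cast_nonneg (α := ℝ) (m + 1))
  refine h2.trans (le_of_eq ?_)
  push_cast
  ring

end

section

variable {n : ℕ}

/-- The two colour classes of a colouring: the red graph and its complement. -/
def colours (G : SimpleGraph (Fin n)) (c : Bool) : SimpleGraph (Fin n) := if c then G else Gᶜ

theorem isColouring_colours (G : SimpleGraph (Fin n)) : IsColouring (colours G) := by
  intro x y hxy
  by_cases h : G.Adj x y
  · exact ⟨true, h⟩
  · exact ⟨false, (SimpleGraph.compl_adj G x y).2 ⟨hxy, h⟩⟩

/-- Swapping the colours lets blue cliques reuse `card_cliques_le`, which counts in `H true`. -/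
theorem isColouring_colours_not (G : SimpleGraph (Fin n)) :
    IsColouring fun c => colours G (!c) := fun x y hxy => by
  obtain ⟨c, hc⟩ := isColouring_colours G x y hxy
  exact ⟨!c, by simpa using hc⟩

theorem isMonochromatic_iff {G : SimpleGraph (Fin n)} {s : Finset (Fin n)} :
    IsMonochromatic G s ↔ ∃ c, (colours G c).IsClique (s : Set (Fin n)) := by
  simp [IsMonochromatic, colours, or_comm]

theorem mem_monoSubgraphs {G : SimpleGraph (Fin n)} {s : Finset (Fin n)} :
    s ∈ monoSubgraphs G ↔ IsMonochromatic G s := by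
  simp [monoSubgraphs]

theorem cliqueBound_of_isMonochromatic {G : SimpleGraph (Fin n)} {m : ℕ}
    (hm : ∀ s, IsMonochromatic G s → s.card ≤ m) (c : Bool) :
    CliqueBound (colours G c) Finset.univ m :=
  fun K _ hK => hm K (isMonochromatic_iff.2 ⟨c, hK⟩)

theorem numMono_le_card_cliques (G : SimpleGraph (Fin n)) (k : ℕ) :
    numMono G k ≤ (cliques (colours G true) k).card + (cliques (colours G false) k).card := by
  classical
  refine le_trans (Finset.card_le_card fun s hs => ?_) (Finset.card_union_le _ _)
  rw [Finset.mem_filter, mem_monoSubgraphs, isMonochromatic_iff] at hs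
  obtain ⟨⟨c, hc⟩, hk⟩ := hs
  rw [Finset.mem_union, mem_cliques, mem_cliques]
  cases c
  · exact Or.inr ⟨hc, hk⟩
  · exact Or.inl ⟨hc, hk⟩

/-- An upper bound for the number of monochromatic subgraphs of a given size, when all of them have
at most `m` vertices. -/
theorem numMono_le {G : SimpleGraph (Fin n)} {m : ℕ}
    (hm : ∀ s, IsMonochromatic G s → s.card ≤ m) {k : ℕ} {r : ℝ} (hr1 : r ≤ 1)
    (hr : k ≤ m → (k : ℝ) / (m + 1) ≤ r) :
    (numMono G k : ℝ)
      ≤ Real.exp ((1 + 2 * ((m : ℝ) + 1)) * Real.log 2 + ((m : ℝ) + 1) ^ 2 * gNat r) := by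
  rcases le_or_gt k m with hk | hk
  · have h1 : ((cliques (colours G true) k).card : ℝ)
        ≤ Real.exp (2 * (m + 1) * Real.log 2 + (m + 1) ^ 2 * gNat (k / (m + 1))) :=
      card_cliques_le (isColouring_colours G) (cliqueBound_of_isMonochromatic hm) (by omega)
    have h2 : ((cliques (colours G false) k).card : ℝ)
        ≤ Real.exp (2 * (m + 1) * Real.log 2 + (m + 1) ^ 2 * gNat (k / (m + 1))) :=
      card_cliques_le (isColouring_colours_not G)
        (fun c => cliqueBound_of_isMonochromatic hm (!c)) (by omega)
    have h3 := (Nat.cast_le (α := ℝ)).2 (numMono_le_card_cliques G k)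
    push_cast at h3
    have h0 : 0 ≤ (k : ℝ) / (m + 1) := by positivity
    have h4 : gNat (k / (m + 1)) ≤ gNat r :=
      strictMonoOn_gNat.monotoneOn ⟨h0, (hr hk).trans hr1⟩ ⟨h0.trans (hr hk), hr1⟩ (hr hk)
    calc (numMono G k : ℝ)
        ≤ 2 * Real.exp (2 * (m + 1) * Real.log 2 + (m + 1) ^ 2 * gNat (k / (m + 1))) := by linarith
      _ ≤ 2 * Real.exp (2 * (m + 1) * Real.log 2 + (m + 1) ^ 2 * gNat r) := by gcongr
      _ = _ := by
        nth_rewrite 1 [← Real.exp_log (show (0 : ℝ) < 2 by norm_num)]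
        rw [← Real.exp_add]
        congr 1
        ring
  · have h1 : numMono G k = 0 := by
      rw [numMono, Finset.card_eq_zero, Finset.filter_eq_empty_iff]
      intro s hs hsk
      have := hm s (mem_monoSubgraphs.1 hs)
      omega
    rw [h1, Nat.cast_zero]
    exact (Real.exp_pos _).le

/-- `gNat` is largest at `1`, and the number `m + 1` of sizes is absorbed by one more `(m + 1) * log
2` in the exponent. -/
theorem totalMono_le {G : SimpleGraph (Fin n)} {m : ℕ}
    (hm : ∀ s, IsMonochromatic G s → s.card ≤ m) :
    (totalMono G : ℝ)
      ≤ Real.exp ((1 + 3 * ((m : ℝ) + 1)) * Real.log 2 + ((m : ℝ) + 1) ^ 2 * gNat 1) := by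
  have h1 : totalMono G = ∑ k ∈ Finset.range (m + 1), numMono G k :=
    Finset.card_eq_sum_card_fiberwise fun s hs => by
      exact Finset.mem_coe.2 (Finset.mem_range.2 (Nat.lt_succ_of_le
        (hm s (mem_monoSubgraphs.1 (Finset.mem_coe.1 hs)))))
  have h2 : ∀ k ∈ Finset.range (m + 1), (numMono G k : ℝ)
      ≤ Real.exp ((1 + 2 * ((m : ℝ) + 1)) * Real.log 2 + ((m : ℝ) + 1) ^ 2 * gNat 1) :=
    fun k _ => numMono_le hm le_rfl fun hk => by
      rw [div_le_one (by positivity)]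
      have : (k : ℝ) ≤ m := by exact_mod_cast hk
      linarith
  have h3 := Finset.sum_le_card_nsmul _ _ _ h2
  rw [Finset.card_range, nsmul_eq_mul] at h3
  have h4 : ((m + 1 : ℕ) : ℝ) ≤ Real.exp (((m : ℝ) + 1) * Real.log 2) := by
    have h5 : ((m + 1 : ℕ) : ℝ) ≤ 2 ^ (m + 1) := by exact_mod_cast Nat.lt_two_pow_self.le
    refine h5.trans (le_of_eq ?_)
    rw [← Real.exp_log (show (0 : ℝ) < 2 ^ (m + 1) by positivity), Real.log_pow]
    push_cast
    rfl
  rw [h1, Nat.cast_sum]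
  refine h3.trans ((mul_le_mul_of_nonneg_right h4 (Real.exp_pos _).le).trans (le_of_eq ?_))
  rw [← Real.exp_add]
  congr 1
  ring

end

/-! ### Asymptotics in `n` and nonexistence of large Half-Ramsey graphs. -/

/-- An integer bound for the sizes of monochromatic subgraphs in Half-Ramsey graphs. -/
noncomputable def maxMono (ε : ℕ → ℝ) (n : ℕ) : ℕ := ⌈(1 / 2 + |ε n|) * Real.logb 2 n⌉₊

theorem logb_natCast_nonneg (n : ℕ) : 0 ≤ Real.logb 2 n := by
  rcases Nat.eq_zero_or_pos n with rfl | hn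
  · simp
  · exact Real.logb_nonneg (by norm_num) (by exact_mod_cast hn)

theorem IsHalfRamsey.card_le {ε : ℕ → ℝ} {n : ℕ} {G : SimpleGraph (Fin n)}
    (hG : IsHalfRamsey ε G) (s : Finset (Fin n)) (hs : IsMonochromatic G s) :
    s.card ≤ maxMono ε n := by
  have h1 := (hG s hs).le
  have h2 : (1 / 2 + ε n) * Real.logb 2 n ≤ (1 / 2 + |ε n|) * Real.logb 2 n :=
    mul_le_mul_of_nonneg_right (by linarith [le_abs_self (ε n)]) (logb_natCast_nonneg n)
  exact_mod_cast (h1.trans h2).trans (Nat.le_ceil _)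

/-- The absolute value in `maxMono` ensures this; it makes the clique bound grow, so that the Ramsey
improvement applies and saves a multiple of `log n`. -/
theorem le_maxMono (ε : ℕ → ℝ) (n : ℕ) : 1 / 2 * Real.logb 2 n ≤ maxMono ε n := by
  refine le_trans ?_ (Nat.le_ceil _)
  exact mul_le_mul_of_nonneg_right (by linarith [abs_nonneg (ε n)]) (logb_natCast_nonneg n)

theorem maxMono_le (ε : ℕ → ℝ) (n : ℕ) :
    (maxMono ε n : ℝ) ≤ (1 / 2 + |ε n|) * Real.logb 2 n + 1 :=
  (Nat.ceil_lt_add_one (mul_nonneg (by positivity) (logb_natCast_nonneg n))).le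

theorem tendsto_logb : Tendsto (fun n : ℕ => Real.logb 2 n) atTop atTop :=
  (Real.tendsto_logb_atTop (by norm_num)).comp tendsto_natCast_atTop_atTop

/-- By the exponential improvement of the Erdős–Szekeres bound (first proved by Campos, Griffiths,
Morris and Sahasrabudhe), there are only finitely many Half-Ramsey graphs. Hence every lower bound
for the numbers of monochromatic subgraphs of large Half-Ramsey graphs holds. -/
theorem eventually_not_isHalfRamsey {ε : ℕ → ℝ} (hε : Tendsto ε atTop (𝓝 0)) :
    ∀ᶠ n : ℕ in atTop, ∀ G : SimpleGraph (Fin n), ¬ IsHalfRamsey ε G := by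
  obtain ⟨c, hc, k₀, hk₀⟩ := exists_exponential_improvement
  have h2 : 0 < Real.log 2 := Real.log_pos (by norm_num)
  have hε' : Tendsto (fun n => |ε n|) atTop (𝓝 0) := by simpa using hε.abs
  -- The saving `c k` is at least `c L / 2`; the error from `ε` and the rounding error `2 * log 2`
  -- are each kept below `c L / 4`.
  filter_upwards [hε'.eventually (gt_mem_nhds (show 0 < c / (8 * Real.log 2) by positivity)),
    tendsto_logb.eventually_ge_atTop (2 * k₀),
    tendsto_logb.eventually_gt_atTop (8 * Real.log 2 / c), eventually_ge_atTop 1]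
    with n h3 h4 h5 h6 G hG
  set L := Real.logb 2 n with hL
  have hlog : Real.log n = L * Real.log 2 := by
    rw [hL, Real.logb, div_mul_cancel₀ _ h2.ne']
  have hk1 := le_maxMono ε n
  have hk2 := maxMono_le ε n
  set k := maxMono ε n with hk
  have hkk : k₀ ≤ k := by
    have : (k₀ : ℝ) ≤ k := by linarith
    exact_mod_cast this
  have : NeZero n := ⟨by omega⟩
  have h := hk₀ k hkk (isColouring_colours G) (S := Finset.univ) Finset.univ_nonempty
    (cliqueBound_of_isMonochromatic hG.card_le)
  rw [Finset.card_univ, Fintype.card_fin, hlog] at h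
  have hL0 : 0 < L := lt_of_le_of_lt (by positivity) h5
  have e1 : 2 * (k : ℝ) * Real.log 2 ≤ 2 * ((1 / 2 + |ε n|) * L + 1) * Real.log 2 := by gcongr
  have e2 : c * (1 / 2 * L) ≤ c * k := by gcongr
  have e3 : |ε n| * (8 * Real.log 2) * L ≤ c * L := by
    rw [lt_div_iff₀ (by positivity)] at h3
    gcongr
  rw [div_lt_iff₀ hc] at h5
  linarith

/-- The exponent of `n ^ log n` in the upper bounds. -/
noncomputable def exponent (ε r : ℕ → ℝ) (n : ℕ) : ℝ :=
  ((1 + 3 * ((maxMono ε n : ℝ) + 1)) + ((maxMono ε n : ℝ) + 1) ^ 2 * (gNat (r n) / Real.log 2))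
    / Real.logb 2 n ^ 2

theorem tendsto_maxMono_div {ε : ℕ → ℝ} (hε : Tendsto ε atTop (𝓝 0)) :
    Tendsto (fun n => ((maxMono ε n : ℝ) + 1) / Real.logb 2 n) atTop (𝓝 (1 / 2)) := by
  have hinv : Tendsto (fun n : ℕ => (Real.logb 2 n)⁻¹) atTop (𝓝 0) :=
    tendsto_inv_atTop_zero.comp tendsto_logb
  have hup : Tendsto (fun n => 1 / 2 + |ε n| + 2 * (Real.logb 2 n)⁻¹) atTop (𝓝 (1 / 2)) := by
    simpa only [abs_zero, mul_zero, add_zero] using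
      (hε.abs.const_add (1 / 2)).add (hinv.const_mul 2)
  refine tendsto_of_tendsto_of_tendsto_of_le_of_le' tendsto_const_nhds hup ?_ ?_
  · filter_upwards [tendsto_logb.eventually_gt_atTop 0] with n hn
    rw [le_div_iff₀ hn]
    linarith [le_maxMono ε n]
  · filter_upwards [tendsto_logb.eventually_gt_atTop 0] with n hn
    rw [div_le_iff₀ hn, add_mul, mul_assoc, inv_mul_cancel₀ hn.ne']
    linarith [maxMono_le ε n]

/-- The clique bound is about `(log n) / 2`, whose square gives the factor `1 / 4`; the linear terms
vanish against `(log n) ^ 2`. -/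
theorem tendsto_exponent {ε : ℕ → ℝ} (hε : Tendsto ε atTop (𝓝 0)) {r : ℕ → ℝ} {u : ℝ}
    (hr : Tendsto r atTop (𝓝 u)) :
    Tendsto (exponent ε r) atTop (𝓝 (1 / 4 * (gNat u / Real.log 2))) := by
  have hinv : Tendsto (fun n : ℕ => (Real.logb 2 n)⁻¹) atTop (𝓝 0) :=
    tendsto_inv_atTop_zero.comp tendsto_logb
  have hm := tendsto_maxMono_div hε
  have hg := ((continuous_gNat.tendsto u).comp hr).div_const (Real.log 2)
  have h := ((hinv.pow 2).add (((hm.mul hinv).const_mul 3))).add ((hm.pow 2).mul hg)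
  have e : (0 : ℝ) ^ 2 + 3 * (1 / 2 * 0) + (1 / 2) ^ 2 * (gNat u / Real.log 2)
      = 1 / 4 * (gNat u / Real.log 2) := by ring
  rw [e] at h
  refine h.congr' ?_
  filter_upwards [tendsto_logb.eventually_gt_atTop 0] with n hn
  simp only [exponent, Function.comp]
  field_simp

theorem exp_le_rpow_logb {n : ℕ} (hn : 0 < Real.logb 2 n) {a b y : ℝ}
    (hy : (a + b / Real.log 2) / Real.logb 2 n ^ 2 ≤ y) :
    Real.exp (a * Real.log 2 + b) ≤ (n : ℝ) ^ (y * Real.logb 2 n) := by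
  have h2 : 0 < Real.log 2 := Real.log_pos (by norm_num)
  have hn0 : (0 : ℝ) < n := by
    rcases Nat.eq_zero_or_pos n with rfl | h
    · simp at hn
    · exact_mod_cast h
  have hlog : Real.log n = Real.logb 2 n * Real.log 2 := by
    rw [Real.logb, div_mul_cancel₀ _ h2.ne']
  rw [Real.rpow_def_of_pos hn0, Real.exp_le_exp, hlog]
  rw [div_le_iff₀ (by positivity)] at hy
  have h3 := mul_le_mul_of_nonneg_right hy h2.le
  rw [add_mul, div_mul_cancel₀ _ h2.ne'] at h3
  linarith

/-- The upper bound for the number of monochromatic subgraphs of a given size. -/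
theorem exists_numMono_le {ε : ℕ → ℝ} (hε : Tendsto ε atTop (𝓝 0)) {c : ℝ} (hc : c ≤ 1 / 2) :
    ∃ η : ℕ → ℝ, Tendsto η atTop (𝓝 0) ∧
      ∀ᶠ n : ℕ in atTop, ∀ G : SimpleGraph (Fin n), IsHalfRamsey ε G →
        ∀ k : ℕ, |(k : ℝ) - c * Real.logb 2 n| < 1 →
          (numMono G k : ℝ) ≤ (n : ℝ) ^ ((g₁ c + η n) * Real.logb 2 n) := by
  -- The relative clique size, covering both roundings of `c log n`. The cap at `1` keeps it where
  -- `gNat` is monotone and does not affect the limit `2 c ≤ 1`.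
  set r : ℕ → ℝ := fun n => min 1 ((c * Real.logb 2 n + 1) / ((maxMono ε n : ℝ) + 1)) with hr
  have hinv : Tendsto (fun n : ℕ => (Real.logb 2 n)⁻¹) atTop (𝓝 0) :=
    tendsto_inv_atTop_zero.comp tendsto_logb
  have hrt : Tendsto r atTop (𝓝 (2 * c)) := by
    have h1 : Tendsto (fun n : ℕ => (c + (Real.logb 2 n)⁻¹)
        / (((maxMono ε n : ℝ) + 1) / Real.logb 2 n)) atTop (𝓝 (2 * c)) := by
      have := (hinv.const_add c).div (tendsto_maxMono_div hε) (by norm_num)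
      rwa [show (c + 0) / (1 / 2) = 2 * c by ring] at this
    have h2 : Tendsto (fun n : ℕ => (c * Real.logb 2 n + 1) / ((maxMono ε n : ℝ) + 1)) atTop
        (𝓝 (2 * c)) := by
      refine h1.congr' ?_
      filter_upwards [tendsto_logb.eventually_gt_atTop 0] with n hn
      field_simp
    have h3 := (tendsto_const_nhds (x := (1 : ℝ))).min h2
    rwa [min_eq_right (by linarith)] at h3
  refine ⟨fun n => exponent ε r n - g₁ c, ?_, ?_⟩
  · have h := (tendsto_exponent hε hrt).sub_const (g₁ c)
    rwa [g₁_eq hc, sub_self, ← g₁_eq hc] at h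
  · filter_upwards [tendsto_logb.eventually_gt_atTop 0] with n hn G hG k hk
    rw [add_sub_cancel]
    refine (numMono_le hG.card_le (r := r n) (min_le_left _ _) fun hkm => ?_).trans
      (exp_le_rpow_logb hn ?_)
    · refine le_min ?_ ?_
      · rw [div_le_one (by positivity)]
        have : (k : ℝ) ≤ maxMono ε n := by exact_mod_cast hkm
        linarith
      · have := (abs_lt.1 hk).2
        gcongr
        linarith
    -- The coefficient `2` is enlarged to `3`, so that one `exponent` serves both counts.
    · unfold exponent
      rw [mul_div_assoc]
      gcongr
      norm_num

/-- The upper bound for the number of all monochromatic subgraphs. -/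
theorem exists_totalMono_le {ε : ℕ → ℝ} (hε : Tendsto ε atTop (𝓝 0)) :
    ∃ η : ℕ → ℝ, Tendsto η atTop (𝓝 0) ∧
      ∀ᶠ n : ℕ in atTop, ∀ G : SimpleGraph (Fin n), IsHalfRamsey ε G →
        (totalMono G : ℝ) ≤ (n : ℝ) ^ ((g₁ (1 / 2) + η n) * Real.logb 2 n) := by
  refine ⟨fun n => exponent ε (fun _ => 1) n - g₁ (1 / 2), ?_, ?_⟩
  · have h := (tendsto_exponent hε (tendsto_const_nhds (x := (1 : ℝ)))).sub_const (g₁ (1 / 2))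
    have e : g₁ (1 / 2) = 1 / 4 * (gNat 1 / Real.log 2) := by
      rw [g₁_eq le_rfl]
      norm_num
    rwa [← e, sub_self] at h
  · filter_upwards [tendsto_logb.eventually_gt_atTop 0] with n hn G hG
    rw [add_sub_cancel]
    refine (totalMono_le hG.card_le).trans (exp_le_rpow_logb hn (le_of_eq ?_))
    unfold exponent
    rw [mul_div_assoc]

theorem numMonoGE_le_totalMono {n : ℕ} (G : SimpleGraph (Fin n)) (x : ℝ) :
    numMonoGE G x ≤ totalMono G :=
  Finset.card_le_card (Finset.filter_subset _ _)

end HalfRamsey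

/-- Profile of Ramsey multiplicities of Half-Ramsey graphs. -/
theorem mainTheorem3 :
    -- `g₁` is concave and increasing on `[0, 1/2]`
    (ConcaveOn ℝ (Set.Icc 0 (1 / 2)) HalfRamsey.g₁ ∧
      StrictMonoOn HalfRamsey.g₁ (Set.Icc 0 (1 / 2))) ∧
    -- the `o(1)` in the definition of a Half-Ramsey graph
    ∀ ε : ℕ → ℝ, Tendsto ε atTop (𝓝 0) →
      -- the number of monochromatic complete subgraphs of size exactly `c log n`,
      -- where `c log n` is rounded up or down to an integer `k`
      (∀ c : ℝ, 0 ≤ c → c ≤ 1 / 2 →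
        ∃ η : ℕ → ℝ, Tendsto η atTop (𝓝 0) ∧
          ∀ᶠ n : ℕ in atTop, ∀ G : SimpleGraph (Fin n), HalfRamsey.IsHalfRamsey ε G →
            ∀ k : ℕ, |(k : ℝ) - c * Real.logb 2 n| < 1 →
              (n : ℝ) ^ ((HalfRamsey.g₁ c - η n) * Real.logb 2 n)
                  ≤ (HalfRamsey.numMono G k : ℝ) ∧
                (HalfRamsey.numMono G k : ℝ)
                  ≤ (n : ℝ) ^ ((HalfRamsey.g₁ c + η n) * Real.logb 2 n)) ∧
      -- the total number; the lower bound holds already for the subgraphs of size at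
      -- least `(1/2) log n`
      ∃ η : ℕ → ℝ, Tendsto η atTop (𝓝 0) ∧
        ∀ᶠ n : ℕ in atTop, ∀ G : SimpleGraph (Fin n), HalfRamsey.IsHalfRamsey ε G →
          (n : ℝ) ^ ((1 / 8 * (4 - Real.logb 2 (Real.exp 1)) - η n) * Real.logb 2 n)
              ≤ (HalfRamsey.numMonoGE G (1 / 2 * Real.logb 2 n) : ℝ) ∧
            (HalfRamsey.numMonoGE G (1 / 2 * Real.logb 2 n) : ℝ)
              ≤ (HalfRamsey.totalMono G : ℝ) ∧
            (HalfRamsey.totalMono G : ℝ)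
              ≤ (n : ℝ) ^ ((1 / 8 * (4 - Real.logb 2 (Real.exp 1)) + η n) * Real.logb 2 n) := by
  refine ⟨⟨HalfRamsey.concaveOn_g₁, HalfRamsey.strictMonoOn_g₁⟩, fun ε hε => ⟨fun c _ hc => ?_, ?_⟩⟩
  · obtain ⟨η, hη, h⟩ := HalfRamsey.exists_numMono_le hε hc
    refine ⟨η, hη, ?_⟩
    -- The lower bound is vacuous once `n` is large; only the upper bound determines `η`.
    filter_upwards [h, HalfRamsey.eventually_not_isHalfRamsey hε] with n h1 h2 G hG k hk
    exact ⟨absurd hG (h2 G), h1 G hG k hk⟩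
  · obtain ⟨η, hη, h⟩ := HalfRamsey.exists_totalMono_le hε
    refine ⟨η, hη, ?_⟩
    rw [HalfRamsey.g₁_half] at h
    filter_upwards [h, HalfRamsey.eventually_not_isHalfRamsey hε] with n h1 h2 G hG
    exact ⟨absurd hG (h2 G), by exact_mod_cast HalfRamsey.numMonoGE_le_totalMono G _, h1 G hG⟩
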